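/- Let $X$ be a compact connected Riemann surface with canonical sheaf $K_X$, $D\ge 0$ an effective divisor on $X$, and $G$ a complex Lie group with Lie algebra $\mathfrak g$, equipped with an $\mathrm{Ad}$-invariant symmetric bilinear form $\mathrm{Tr}:\mathfrak g\times\mathfrak g\to\mathbb C$. Let $P\to X$ be a holomorphic principal $G$-bundle and $\theta\in H^0(X,\mathrm{ad}\,P\otimes K_X(D))$, and write $\mathrm{ad}\,\theta(s)=[\theta,s]$. Consider the complexes, placed in degrees $0$ and $1$, $$\mathscr K^\bullet=\bigl(\mathrm{ad}\,P\xrightarrow{\ \mathrm{ad}\,\theta\ }\mathrm{ad}\,P\otimes K_X(D)\bigr),\qquad \check{\mathscr K}^\bullet\otimes K_X=\bigl((\mathrm{ad}\,P)^\vee(-D)\xrightarrow{\ -(\mathrm{ad}\,\theta)^\vee\ }(\mathrm{ad}\,P)^\vee\otimes K_X\bigr),$$ where $\check{\mathscr K}^\bullet=\mathcal Hom^\bullet(\mathscr K^\bullet,\mathcal O_X)[-1]$ (the sign of the differential is the sign of the shift). The form $\mathrm{Tr}$ induces, by $x\mapsto\mathrm{Tr}(x,\cdot)$ in both degrees, a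 morphism of complexes $$\bigl(\mathrm{ad}\,P(-D)\xrightarrow{\ \mathrm{ad}\,\theta\ }\mathrm{ad}\,P\otimes K_X\bigr)\longrightarrow\check{\mathscr K}^\bullet\otimes K_X,$$ which is an isomorphism when $\mathrm{Tr}$ is nondegenerate; through it, classes of the left-hand complex are regarded as classes of $\check{\mathscr K}^\bullet\otimes K_X$. For a complex of sheaves $F^\bullet$ in degrees $0,1$, hypercohomology is computed by total Čech complexes (passing to the limit over open covers), the differential on $\check C^p(F^q)$ being $d_F+(-1)^q\delta$; thus a Čech $1$-cocycle of $F^\bullet$ for an open cover $\mathfrak U=(U_i)$ is a pair $(\underline s,\underline t)\in\check C^1_{\mathfrak U}(F^0)\oplus\check C^0_{\mathfrak U}(F^1)$ with $\delta\underline s=0$ and $d_F(s_{ij})=t_j-t_i$. The duality pairing $$\mathbb H^1(\mathscr K^\bullet)\otimes\mathbb H^1(\check{\mathscr K}^\bullet\otimes K_X)\longrightarrow H^1(X,K_X)$$ is the composition of the cup product into $\mathbb H^2(\mathscr K^\bullet\otimes(\check{\mathscr K}^\bullet\otimes K_X))$, given on total cochains of degrees $n$ and $m$ by $$(\alpha\cup\beta)_{i_0\dots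 i_p}=\sum_{r=0}^p(-1)^{r(m-(p-r))}\,\alpha_{i_0\dots i_r}\otimes\beta_{i_r\dots i_p},$$ with the map induced by the contraction of complexes $\mathscr K^\bullet\otimes(\check{\mathscr K}^\bullet\otimes K_X)\to K_X[-1]$, that is, by the evaluations $(t,l)\mapsto l(t)$ on $(\mathrm{ad}\,P\otimes K_X(D))\otimes(\mathrm{ad}\,P)^\vee(-D)$ and $(s,l)\mapsto l(s)$ on $\mathrm{ad}\,P\otimes((\mathrm{ad}\,P)^\vee\otimes K_X)$. **Proposition.** Let $\mathfrak U=(U_i)$ be an open cover of $X$ (for example an acyclic one), and let $\alpha=[(\underline s,\underline t)]\in\mathbb H^1(\mathscr K^\bullet)$ and $\beta=[(\underline\sigma,\underline\tau)]\in\mathbb H^1(\check{\mathscr K}^\bullet\otimes K_X)$ be the classes of Čech cocycles $$(\underline s,\underline t)\in\check C^1_{\mathfrak U}(\mathrm{ad}\,P)\oplus\check C^0_{\mathfrak U}(\mathrm{ad}\,P\otimes K_X(D)),\qquad(\underline\sigma,\underline\tau)\in\check C^1_{\mathfrak U}(\mathrm{ad}\,P(-D))\oplus\check C^0_{\mathfrak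 U}(\mathrm{ad}\,P\otimes K_X).$$ Then $$c_{ij}=\mathrm{Tr}(t_i,\sigma_{ij})-\mathrm{Tr}(s_{ij},\tau_j)\in K_X(U_i\cap U_j)$$ defines a Čech $1$-cocycle $\underline c=(c_{ij})$ of $K_X$, and the duality pairing sends $\alpha\otimes\beta$ to its class $[\underline c]\in H^1(X,K_X)$. -/

import Mathlib

open scoped Manifold ContDiff Topology
open CategoryTheory Opposite TopologicalSpace

universe u v w

noncomputable section
namespace HiggsDuality

section Cech

variable {X : Type u} [TopologicalSpace X]

/-- Presheaves of complex vector spaces on a topological space. -/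
abbrev Psh (X : Type u) [TopologicalSpace X] := (Opens X)ᵒᵖ ⥤ ModuleCat.{u} ℂ

/-- Restriction of sections to a smaller open set. -/
def rs (F : Psh X) {U V : Opens X} (h : V ≤ U) : F.obj (op U) →ₗ[ℂ] F.obj (op V) :=
  (F.map (homOfLE h).op).hom

theorem rs_rs (F : Psh X) {U V W : Opens X} (h : V ≤ U) (h' : W ≤ V) (s : F.obj (op U)) :
    rs F h' (rs F h s) = rs F (h'.trans h) s := by
  have := F.map_comp (homOfLE h).op (homOfLE h').op
  have h2 : (homOfLE h).op ≫ (homOfLE h').op = (homOfLE (h'.trans h)).op := rfl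
  rw [h2] at this
  simp [rs, this]

theorem rs_self (F : Psh X) {U : Opens X} (h : U ≤ U) (s : F.obj (op U)) : rs F h s = s := by
  have h2 : (homOfLE h).op = 𝟙 (op U) := rfl
  rw [rs, h2]
  simp

theorem app_rs {F G : Psh X} (f : F ⟶ G) {U V : Opens X} (h : V ≤ U) (s : F.obj (op U)) :
    (f.app (op V)).hom (rs F h s) = rs G h ((f.app (op U)).hom s) := by
  have := f.naturality (homOfLE h).op
  exact congrArg (fun k => k.hom s) this

variable {ι : Type v} {κ : Type w}

/-- The intersection of the members of a family of open sets with the given indices. -/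
def inter (U : ι → Opens X) {p : ℕ} (i : Fin p → ι) : Opens X := ⨅ a, U (i a)

theorem inter_comp_le (U : ι → Opens X) {p q : ℕ} (i : Fin p → ι) (e : Fin q → Fin p) :
    inter U i ≤ inter U (i ∘ e) :=
  le_iInf fun a => iInf_le (fun b => U (i b)) (e a)

/-- Čech `p`-cochains of the family `U` with coefficients in `F`: a section over each
`(p + 1)`-fold intersection. -/
abbrev Cech (U : ι → Opens X) (F : Psh X) (p : ℕ) := ∀ i : Fin (p + 1) → ι, F.obj (op (inter U i))

/-- The Čech differential `(δ c)_{i₀…i_{p+1}} = ∑ₖ (-1)ᵏ c_{i₀…îₖ…i_{p+1}}`. -/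
def cechD (U : ι → Opens X) (F : Psh X) (p : ℕ) : Cech U F p →ₗ[ℂ] Cech U F (p + 1) :=
  LinearMap.pi fun i => ∑ k : Fin (p + 2), (-1 : ℂ) ^ (k : ℕ) •
    (rs F (inter_comp_le U i k.succAbove) ∘ₗ LinearMap.proj (i ∘ k.succAbove))

/-- The map on Čech cochains induced by a morphism of presheaves. -/
def cechMap (U : ι → Opens X) {F G : Psh X} (f : F ⟶ G) (p : ℕ) : Cech U F p →ₗ[ℂ] Cech U G p :=
  LinearMap.pi fun i => (f.app (op (inter U i))).hom ∘ₗ LinearMap.proj i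

/-- Degree `n` of the total Čech complex of a complex of presheaves: the sum over `p + q = n` of
the Čech `p`-cochains with coefficients in the `q`-th term. -/
abbrev Tot (U : ι → Opens X) (F : CochainComplex (Psh X) ℕ) (n : ℕ) :=
  ∀ a : {a : ℕ × ℕ // a.1 + a.2 = n}, Cech U (F.X a.1.2) a.1.1

/-- The component of a total cochain of Čech degree `p` and coefficient degree `q`. -/
def Tot.comp {U : ι → Opens X} {F : CochainComplex (Psh X) ℕ} {n : ℕ} (p q : ℕ) (h : p + q = n) :
    Tot U F n →ₗ[ℂ] Cech U (F.X q) p :=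
  LinearMap.proj (⟨(p, q), h⟩ : {a : ℕ × ℕ // a.1 + a.2 = n})

/-- The Čech part of the differential of the total complex: `(-1)^q δ` on `q`-th coefficients. -/
def totDCech (U : ι → Opens X) (F : CochainComplex (Psh X) ℕ) (n : ℕ) :
    ∀ p q : ℕ, p + q = n + 1 → (Tot U F n →ₗ[ℂ] Cech U (F.X q) p)
  | 0, _, _ => 0
  | p + 1, q, _ => (-1 : ℂ) ^ q • (cechD U (F.X q) p ∘ₗ Tot.comp p q (by omega))

/-- The part of the differential of the total complex induced by the differential of `F`. -/
def totDCoeff (U : ι → Opens X) (F : CochainComplex (Psh X) ℕ) (n : ℕ) :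
    ∀ p q : ℕ, p + q = n + 1 → (Tot U F n →ₗ[ℂ] Cech U (F.X q) p)
  | _, 0, _ => 0
  | p, q + 1, _ => cechMap U (F.d q (q + 1)) p ∘ₗ Tot.comp p q (by omega)

/-- The differential of the total Čech complex. -/
def totD (U : ι → Opens X) (F : CochainComplex (Psh X) ℕ) (n : ℕ) :
    Tot U F n →ₗ[ℂ] Tot U F (n + 1) :=
  LinearMap.pi fun a => totDCech U F n a.1.1 a.1.2 a.2 + totDCoeff U F n a.1.1 a.1.2 a.2

/-- Cocycles of the total Čech complex. -/
def cocycles (U : ι → Opens X) (F : CochainComplex (Psh X) ℕ) (n : ℕ) : Submodule ℂ (Tot U F n) :=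
  LinearMap.ker (totD U F n)

/-- Coboundaries of the total Čech complex. -/
def coboundaries (U : ι → Opens X) (F : CochainComplex (Psh X) ℕ) :
    ∀ n : ℕ, Submodule ℂ (Tot U F n)
  | 0 => ⊥
  | n + 1 => LinearMap.range (totD U F n)

/-- The `n`-th Čech hypercohomology of the complex `F` with respect to the family `U`. -/
abbrev HCov (U : ι → Opens X) (F : CochainComplex (Psh X) ℕ) (n : ℕ) :=
  cocycles U F n ⧸ (coboundaries U F n).comap (cocycles U F n).subtype

/-! ### Refinement -/

theorem inter_refine {U : ι → Opens X} {W : κ → Opens X} (r : κ → ι) (h : ∀ k, W k ≤ U (r k))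
    {p : ℕ} (i : Fin p → κ) : inter W i ≤ inter U (r ∘ i) :=
  iInf_mono fun a => h (i a)

/-- Restriction of Čech cochains along a refinement of families. -/
def refCech {U : ι → Opens X} {W : κ → Opens X} (r : κ → ι) (h : ∀ k, W k ≤ U (r k))
    (F : Psh X) (p : ℕ) : Cech U F p →ₗ[ℂ] Cech W F p :=
  LinearMap.pi fun i => rs F (inter_refine r h i) ∘ₗ LinearMap.proj (r ∘ i)

/-- Restriction of total Čech cochains along a refinement of families. -/
def refTot {U : ι → Opens X} {W : κ → Opens X} (r : κ → ι) (h : ∀ k, W k ≤ U (r k))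
    (F : CochainComplex (Psh X) ℕ) (n : ℕ) : Tot U F n →ₗ[ℂ] Tot W F n :=
  LinearMap.pi fun a => refCech r h (F.X a.1.2) a.1.1 ∘ₗ LinearMap.proj a

theorem totD_refTot {U : ι → Opens X} {W : κ → Opens X} (r : κ → ι) (h : ∀ k, W k ≤ U (r k))
    (F : CochainComplex (Psh X) ℕ) (n : ℕ) (α : Tot U F n) :
    totD W F n (refTot r h F n α) = refTot r h F (n + 1) (totD U F n α) := by
  funext ⟨⟨p, q⟩, hpq⟩ i
  have h1 : totDCech W F n p q hpq (refTot r h F n α) i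
      = rs (F.X q) (inter_refine r h i) (totDCech U F n p q hpq α (r ∘ i)) := by
    cases p with
    | zero => simp [totDCech]
    | succ p =>
      simp only [totDCech, cechD, refTot, refCech, Tot.comp, LinearMap.smul_apply,
        LinearMap.comp_apply, LinearMap.proj_apply, LinearMap.pi_apply, Pi.smul_apply,
        LinearMap.sum_apply, map_smul, map_sum, rs_rs]
      rfl
  have h2 : totDCoeff W F n p q hpq (refTot r h F n α) i
      = rs (F.X q) (inter_refine r h i) (totDCoeff U F n p q hpq α (r ∘ i)) := by
    cases q with
    | zero => simp [totDCoeff]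
    | succ q =>
      simp only [totDCoeff, cechMap, refTot, refCech, Tot.comp, LinearMap.comp_apply,
        LinearMap.proj_apply, LinearMap.pi_apply, app_rs]
  simp only [totD, refTot, refCech, LinearMap.pi_apply, LinearMap.add_apply, Pi.add_apply,
    LinearMap.comp_apply, LinearMap.proj_apply, map_add]
  exact congrArg₂ (· + ·) h1 h2

theorem refTot_mem_cocycles {U : ι → Opens X} {W : κ → Opens X} (r : κ → ι)
    (h : ∀ k, W k ≤ U (r k)) (F : CochainComplex (Psh X) ℕ) (n : ℕ) (α : Tot U F n)
    (hα : α ∈ cocycles U F n) : refTot r h F n α ∈ cocycles W F n := by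
  have : totD U F n α = 0 := hα
  change totD W F n _ = 0
  rw [totD_refTot, this, map_zero]

theorem refTot_mem_coboundaries {U : ι → Opens X} {W : κ → Opens X} (r : κ → ι)
    (h : ∀ k, W k ≤ U (r k)) (F : CochainComplex (Psh X) ℕ) (n : ℕ) (α : Tot U F n)
    (hα : α ∈ coboundaries U F n) : refTot r h F n α ∈ coboundaries W F n := by
  cases n with
  | zero =>
    have : α = 0 := hα
    rw [this, map_zero]; exact zero_mem _
  | succ n =>
    obtain ⟨x, rfl⟩ := hα
    exact ⟨refTot r h F n x, totD_refTot r h F n x⟩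

/-- Restriction of cocycles along a refinement. -/
def refCocycles {U : ι → Opens X} {W : κ → Opens X} (r : κ → ι) (h : ∀ k, W k ≤ U (r k))
    (F : CochainComplex (Psh X) ℕ) (n : ℕ) : cocycles U F n →ₗ[ℂ] cocycles W F n :=
  (refTot r h F n).restrict (refTot_mem_cocycles r h F n)

/-- The map on Čech hypercohomology induced by a refinement. -/
def refH {U : ι → Opens X} {W : κ → Opens X} (r : κ → ι) (h : ∀ k, W k ≤ U (r k))
    (F : CochainComplex (Psh X) ℕ) (n : ℕ) : HCov U F n →ₗ[ℂ] HCov W F n :=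
  Submodule.mapQ _ _ (refCocycles r h F n) fun α hα =>
    refTot_mem_coboundaries r h F n α.1 hα

/-! ### Hypercohomology -/

/-- Open covers of `X` indexed by the points of `X`, the member with index `x` containing `x`.
Every open cover is refined by one of this kind. -/
def PtCover (X : Type u) [TopologicalSpace X] := {V : X → Opens X // ∀ x, x ∈ V x}

/-- `V ≤ W` when `W` refines `V`, index by index. -/
instance : Preorder (PtCover X) where
  le V W := ∀ x, W.1 x ≤ V.1 x
  le_refl _ _ := le_rfl
  le_trans _ _ _ h h' x := (h' x).trans (h x)

instance : DecidableEq (PtCover X) := Classical.decEq _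

/-- The `n`-th hypercohomology of `X` with coefficients in the complex `F`: the direct limit over
all open covers of the Čech hypercohomology. -/
abbrev Hyper (F : CochainComplex (Psh X) ℕ) (n : ℕ) :=
  Module.DirectLimit (R := ℂ) (fun V : PtCover X => HCov V.1 F n)
    (fun _ _ h => refH id h F n)

/-- The class in `Hyper F n` of a total Čech cocycle of an arbitrary open cover. -/
def hyperClass {U : ι → Opens X} (hU : ∀ x, ∃ i, x ∈ U i) {F : CochainComplex (Psh X) ℕ} {n : ℕ}
    (z : cocycles U F n) : Hyper F n :=
  Module.DirectLimit.of ℂ (PtCover X) (fun V : PtCover X => HCov V.1 F n)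
    (fun _ _ h => refH id h F n)
    ⟨fun x => U (hU x).choose, fun x => (hU x).choose_spec⟩
    (refH (fun x => (hU x).choose) (fun _ => le_rfl) F n (Submodule.Quotient.mk z))

/-! ### Complexes with at most two terms -/

/-- The zero presheaf. -/
def zeroPsh (X : Type u) [TopologicalSpace X] : Psh X :=
  (Functor.const _).obj (ModuleCat.of ℂ PUnit)

/-- The terms of the complex `A ⟶ B` placed in degrees `0` and `1`. -/
def twoX (A B : Psh X) : ℕ → Psh X
  | 0 => A
  | 1 => B
  | _ + 2 => zeroPsh X

/-- The differentials of the complex `A ⟶ B` placed in degrees `0` and `1`. -/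
def twoD {A B : Psh X} (f : A ⟶ B) : ∀ n, twoX A B n ⟶ twoX A B (n + 1)
  | 0 => f
  | _ + 1 => 0

/-- The complex `A ⟶ B` placed in degrees `0` and `1`. -/
def twoTerm {A B : Psh X} (f : A ⟶ B) : CochainComplex (Psh X) ℕ :=
  CochainComplex.of (twoX A B) (twoD f) fun n => by cases n <;> exact Limits.comp_zero

/-- A presheaf, as a complex concentrated in degree `0`. -/
def conc (K : Psh X) : CochainComplex (Psh X) ℕ := twoTerm (0 : K ⟶ zeroPsh X)

/-- The degree one total cochain `(s, t)` of the complex `A ⟶ B`, with `s` a Čech `1`-cochain in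
`A` and `t` a Čech `0`-cochain in `B`. -/
def mkTot {A B : Psh X} (f : A ⟶ B) (U : ι → Opens X) (s : Cech U A 1) (t : Cech U B 0) :
    Tot U (twoTerm f) 1
  | ⟨(1, 0), _⟩ => s
  | ⟨(0, 1), _⟩ => t
  | ⟨(0, 0), h⟩ => absurd h (by simp)
  | ⟨(0, q + 2), h⟩ => absurd h (by simp)
  | ⟨(1, q + 1), h⟩ => absurd h (by simp)
  | ⟨(p + 2, q), h⟩ => absurd h (by simp; omega)

/-- A Čech `1`-cochain of `K`, as a total cochain of the complex concentrated in degree `0`. -/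
def mkConc (K : Psh X) (U : ι → Opens X) (c : Cech U K 1) : Tot U (conc K) 1 :=
  mkTot (0 : K ⟶ zeroPsh X) U c (fun _ => PUnit.unit)

/-! ### The cup product and the contraction pairing -/

/-- A morphism of complexes `F ⊗ G ⟶ K[-N]`, given by the bilinear maps
`F^a × G^b → K` on sections; these are zero unless `a + b = N`, commute with restriction, and are
compatible with the differential `d x ⊗ y + (-1)^a x ⊗ d y` of the tensor product. -/
structure Contraction (F G : CochainComplex (Psh X) ℕ) (K : Psh X) (N : ℕ) where
  pair : ∀ (a b : ℕ) (U : Opens X),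
    (F.X a).obj (op U) →ₗ[ℂ] (G.X b).obj (op U) →ₗ[ℂ] K.obj (op U)
  degree : ∀ a b U, a + b ≠ N → pair a b U = 0
  natural : ∀ (a b : ℕ) (U V : Opens X) (h : V ≤ U) x y,
    rs K h (pair a b U x y) = pair a b V (rs (F.X a) h x) (rs (G.X b) h y)
  leibniz : ∀ (a b : ℕ) (U : Opens X), a + b + 1 = N → ∀ (x : (F.X a).obj (op U))
    (y : (G.X b).obj (op U)),
    pair (a + 1) b U (((F.d a (a + 1)).app (op U)).hom x) y
      + (-1 : ℂ) ^ a • pair a (b + 1) U x (((G.d b (b + 1)).app (op U)).hom y) = 0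

/-- The inclusion of the indices `0, …, r` in `0, …, p`. -/
def front {p r : ℕ} (h : r ≤ p) (a : Fin (r + 1)) : Fin (p + 1) := ⟨a, by omega⟩

/-- The inclusion of the indices `r, …, p` in `0, …, p`. -/
def back {p r : ℕ} (h : r ≤ p) (a : Fin (p - r + 1)) : Fin (p + 1) := ⟨r + a, by omega⟩

variable {F G : CochainComplex (Psh X) ℕ} {K : Psh X} {N : ℕ}

/-- The cup product of total cochains `α` of degree `n` and `β` of degree `m`, followed by the
contraction: its component of Čech degree `p` is
`(α ∪ β)_{i₀…i_p} = ∑ᵣ (-1)^{r (m - (p - r))} ⟨α_{i₀…iᵣ}, β_{iᵣ…i_p}⟩`, where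
`α_{i₀…iᵣ}` lies in `F^{n - r}` and `β_{iᵣ…i_p}` in `G^{m - (p - r)}`. -/
def cup (μ : Contraction F G K N) (U : ι → Opens X) (n m p : ℕ) (α : Tot U F n) (β : Tot U G m) :
    Cech U K p := fun i =>
  ∑ r : Fin (p + 1),
    if h : r ≤ n ∧ p - r ≤ m then
      (-1 : ℂ) ^ ((r : ℕ) * (m - (p - r))) •
        μ.pair (n - r) (m - (p - r)) (inter U i)
          (rs _ (inter_comp_le U i (front (Nat.le_of_lt_succ r.2)))
            (α.comp r (n - r) (by omega) (i ∘ front (Nat.le_of_lt_succ r.2))))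
          (rs _ (inter_comp_le U i (back (Nat.le_of_lt_succ r.2)))
            (β.comp (p - r) (m - (p - r)) (by omega) (i ∘ back (Nat.le_of_lt_succ r.2))))
    else 0

theorem rs_congr (F : Psh X) (U : ι → Opens X) {p q : ℕ} (c : Cech U F p) (i : Fin q → ι)
    {j j' : Fin (p + 1) → ι} (e : j = j') (h : inter U i ≤ inter U j) (h' : inter U i ≤ inter U j') :
    rs F h (c j) = rs F h' (c j') := by
  subst e; rfl

/-- Evaluation of the cup product of two total cochains of degree one in Čech degree one. -/
theorem cup_one (μ : Contraction F G K N) (U : ι → Opens X) (α : Tot U F 1) (β : Tot U G 1)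
    (i : Fin 2 → ι) :
    cup μ U 1 1 1 α β i =
      μ.pair 1 0 (inter U i) (rs _ (inter_comp_le U i (fun _ => 0)) (α.comp 0 1 rfl (i ∘ fun _ => 0)))
        (β.comp 1 0 rfl i)
      - μ.pair 0 1 (inter U i) (α.comp 1 0 rfl i)
        (rs _ (inter_comp_le U i (fun _ => 1)) (β.comp 0 1 rfl (i ∘ fun _ => 1))) := by
  refine (Fin.sum_univ_two _).trans ?_
  rw [dif_pos (by simp), dif_pos (by simp), sub_eq_add_neg]
  congr 1
  · change (-1 : ℂ) ^ 0 • μ.pair 1 0 (inter U i) _ _ = _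
    rw [pow_zero, one_smul]
    congr 1
    · congr 1
      exact rs_congr (F.X 1) U (α.comp 0 1 rfl) i (by funext a; fin_cases a; rfl) _ _
    · refine Eq.trans ?_ (rs_self (G.X 0) le_rfl _)
      exact rs_congr (G.X 0) U (β.comp 1 0 rfl) i (by funext a; fin_cases a <;> rfl) _ _
  · change (-1 : ℂ) ^ 1 • μ.pair 0 1 (inter U i) _ _ = _
    rw [pow_one, neg_one_smul]
    congr 2
    · congr 1
      refine Eq.trans ?_ (rs_self (F.X 0) le_rfl _)
      exact rs_congr (F.X 0) U (α.comp 1 0 rfl) i (by funext a; fin_cases a <;> rfl) _ _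
    · exact rs_congr (G.X 1) U (β.comp 0 1 rfl) i (by funext a; fin_cases a; rfl) _ _

/-- The cup product with contraction, as a bilinear map on total cochains of degree one. -/
def cupOne (μ : Contraction F G K N) (U : ι → Opens X) :
    Tot U F 1 →ₗ[ℂ] Tot U G 1 →ₗ[ℂ] Cech U K 1 :=
  LinearMap.mk₂ ℂ (cup μ U 1 1 1)
    (fun α α' β => by
      funext i; simp only [cup_one, Pi.add_apply, map_add, LinearMap.add_apply]; abel)
    (fun c α β => by
      funext i; simp only [cup_one, Pi.smul_apply, map_smul, LinearMap.smul_apply, smul_sub])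
    (fun α β β' => by
      funext i; simp only [cup_one, Pi.add_apply, map_add]; abel)
    (fun c α β => by
      funext i; simp only [cup_one, Pi.smul_apply, map_smul, smul_sub])

theorem cechD_apply (U : ι → Opens X) (F : Psh X) (p : ℕ) (c : Cech U F p)
    (i : Fin (p + 2) → ι) : cechD U F p c i = ∑ k : Fin (p + 2), (-1 : ℂ) ^ (k : ℕ) •
      rs F (inter_comp_le U i k.succAbove) (c (i ∘ k.succAbove)) := by
  simp [cechD]

theorem cechD_zero_apply (U : ι → Opens X) (F : Psh X) (c : Cech U F 0) (i : Fin 2 → ι) :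
    cechD U F 0 c i = rs F (inter_comp_le U i (fun _ => 1)) (c (i ∘ fun _ => 1))
      - rs F (inter_comp_le U i (fun _ => 0)) (c (i ∘ fun _ => 0)) := by
  refine (cechD_apply U F 0 c i).trans ((Fin.sum_univ_two _).trans ?_)
  rw [sub_eq_add_neg]
  congr 1
  · simp only [Fin.val_zero, pow_zero, one_smul]
    exact rs_congr F U c i (by funext a; fin_cases a; rfl) _ _
  · simp only [Fin.val_one, pow_one, neg_one_smul]
    congr 1
    exact rs_congr F U c i (by funext a; fin_cases a; rfl) _ _

theorem cechD_one_apply (U : ι → Opens X) (F : Psh X) (c : Cech U F 1) (i : Fin 3 → ι) :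
    cechD U F 1 c i = rs F (inter_comp_le U i ![1, 2]) (c (i ∘ ![1, 2]))
      - rs F (inter_comp_le U i ![0, 2]) (c (i ∘ ![0, 2]))
      + rs F (inter_comp_le U i ![0, 1]) (c (i ∘ ![0, 1])) := by
  refine (cechD_apply U F 1 c i).trans ((Fin.sum_univ_three _).trans ?_)
  rw [sub_eq_add_neg]
  congr 1
  · congr 1
    · simp only [Fin.val_zero, pow_zero, one_smul]
      exact rs_congr F U c i (by funext a; fin_cases a <;> rfl) _ _
    · simp only [Fin.val_one, pow_one, neg_one_smul]
      congr 1
      exact rs_congr F U c i (by funext a; fin_cases a <;> rfl) _ _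
  · simp only [Fin.val_two, even_two, Even.neg_pow, one_pow, one_smul]
    exact rs_congr F U c i (by funext a; fin_cases a <;> rfl) _ _

theorem mem_cocycles_one {U : ι → Opens X} {α : Tot U F 1} (h : α ∈ cocycles U F 1) :
    cechD U (F.X 0) 1 (α.comp 1 0 rfl) = 0 ∧
      cechMap U (F.d 0 1) 1 (α.comp 1 0 rfl) = cechD U (F.X 1) 0 (α.comp 0 1 rfl) ∧
      cechMap U (F.d 1 2) 0 (α.comp 0 1 rfl) = 0 := by
  have h : totD U F 1 α = 0 := h
  refine ⟨?_, ?_, ?_⟩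
  · have := congrFun h ⟨(2, 0), rfl⟩
    simpa [totD, totDCech, totDCoeff] using this
  · have := congrFun h ⟨(1, 1), rfl⟩
    simp [totD, totDCech, totDCoeff] at this
    exact (neg_add_eq_zero.1 this).symm
  · have := congrFun h ⟨(0, 2), rfl⟩
    simpa [totD, totDCech, totDCoeff] using this

theorem mkConc_mem_cocycles {U : ι → Opens X} {c : Cech U K 1} (h : cechD U K 1 c = 0) :
    mkConc K U c ∈ cocycles U (conc K) 1 := by
  change totD U (conc K) 1 _ = 0
  funext ⟨⟨p, q⟩, hpq⟩
  replace hpq : p + q = 2 := hpq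
  have hpq' : (p = 2 ∧ q = 0) ∨ (p = 1 ∧ q = 1) ∨ (p = 0 ∧ q = 2) := by omega
  rcases hpq' with ⟨rfl, rfl⟩ | ⟨rfl, rfl⟩ | ⟨rfl, rfl⟩
  · simp only [totD, totDCech, totDCoeff, LinearMap.pi_apply]
    simp
    exact h
  · exact Subsingleton.elim (α := ∀ i : Fin 2 → ι, PUnit) _ _
  · exact Subsingleton.elim (α := ∀ i : Fin 1 → ι, PUnit) _ _

/-- A Čech `0`-cochain of `K`, as a total cochain of the complex concentrated in degree `0`. -/
def mkConcZero (K : Psh X) (U : ι → Opens X) (e : Cech U K 0) : Tot U (conc K) 0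
  | ⟨(0, 0), _⟩ => e
  | ⟨(p + 1, q), h⟩ => absurd h (by simp)
  | ⟨(0, q + 1), h⟩ => absurd h (by simp)

theorem mkConc_mem_coboundaries {U : ι → Opens X} {c : Cech U K 1} (e : Cech U K 0)
    (h : cechD U K 0 e = c) :
    mkConc K U c ∈ coboundaries U (conc K) 1 := by
  refine ⟨mkConcZero K U e, ?_⟩
  funext ⟨⟨p, q⟩, hpq⟩
  replace hpq : p + q = 1 := hpq
  have hpq' : (p = 1 ∧ q = 0) ∨ (p = 0 ∧ q = 1) := by omega
  rcases hpq' with ⟨rfl, rfl⟩ | ⟨rfl, rfl⟩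
  · simp only [totD, totDCech, totDCoeff, LinearMap.pi_apply]
    simp
    exact h
  · exact Subsingleton.elim (α := ∀ i : Fin 1 → ι, PUnit) _ _

theorem Contraction.leibniz_zero (μ : Contraction F G K 1) (U : Opens X) (x : (F.X 0).obj (op U))
    (y : (G.X 0).obj (op U)) :
    μ.pair 1 0 U (((F.d 0 1).app (op U)).hom x) y
      + μ.pair 0 1 U x (((G.d 0 1).app (op U)).hom y) = 0 := by
  have := μ.leibniz 0 0 U rfl x y
  rwa [pow_zero, one_smul] at this

theorem rs_cup_one (μ : Contraction F G K N) (U : ι → Opens X) (α : Tot U F 1) (β : Tot U G 1)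
    {q : ℕ} (i : Fin q → ι) (k l : Fin q) :
    rs K (inter_comp_le U i ![k, l]) (cup μ U 1 1 1 α β (i ∘ ![k, l])) =
      μ.pair 1 0 (inter U i)
        (rs _ (inter_comp_le U i (fun _ => k)) (α.comp 0 1 rfl (i ∘ fun _ => k)))
        (rs _ (inter_comp_le U i ![k, l]) (β.comp 1 0 rfl (i ∘ ![k, l])))
      - μ.pair 0 1 (inter U i) (rs _ (inter_comp_le U i ![k, l]) (α.comp 1 0 rfl (i ∘ ![k, l])))
        (rs _ (inter_comp_le U i (fun _ => l)) (β.comp 0 1 rfl (i ∘ fun _ => l))) := by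
  rw [cup_one, map_sub, μ.natural, μ.natural, rs_rs, rs_rs]
  congr 1

theorem rs_cocycle {U : ι → Opens X} {α : Tot U F 1} (h : α ∈ cocycles U F 1)
    {q : ℕ} (i : Fin q → ι) (k l : Fin q) :
    ((F.d 0 1).app (op (inter U i))).hom
        (rs _ (inter_comp_le U i ![k, l]) (α.comp 1 0 rfl (i ∘ ![k, l])))
      = rs _ (inter_comp_le U i (fun _ => l)) (α.comp 0 1 rfl (i ∘ fun _ => l))
        - rs _ (inter_comp_le U i (fun _ => k)) (α.comp 0 1 rfl (i ∘ fun _ => k)) := by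
  have := congrFun (mem_cocycles_one h).2.1 (i ∘ ![k, l])
  rw [cechD_zero_apply] at this
  rw [app_rs]
  refine (congrArg (rs (F.X 1) (inter_comp_le U i ![k, l])) this).trans ?_
  rw [map_sub, rs_rs, rs_rs]
  congr 1

theorem cup_cocycle (μ : Contraction F G K 1) (U : ι → Opens X) {α : Tot U F 1} {β : Tot U G 1}
    (hα : α ∈ cocycles U F 1) (hβ : β ∈ cocycles U G 1) :
    cechD U K 1 (cup μ U 1 1 1 α β) = 0 := by
  funext i
  have a1 := congrFun (mem_cocycles_one hα).1 i
  have b1 := congrFun (mem_cocycles_one hβ).1 i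
  rw [cechD_one_apply] at a1 b1 ⊢
  rw [rs_cup_one, rs_cup_one, rs_cup_one]
  have a2 := rs_cocycle hα i 0 1
  have b2 := rs_cocycle hβ i 1 2
  set A12 := rs _ (inter_comp_le U i ![1, 2]) (α.comp 1 0 rfl (i ∘ ![1, 2]))
  set A02 := rs _ (inter_comp_le U i ![0, 2]) (α.comp 1 0 rfl (i ∘ ![0, 2]))
  set A01 := rs _ (inter_comp_le U i ![0, 1]) (α.comp 1 0 rfl (i ∘ ![0, 1]))
  set B12 := rs _ (inter_comp_le U i ![1, 2]) (β.comp 1 0 rfl (i ∘ ![1, 2]))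
  set B02 := rs _ (inter_comp_le U i ![0, 2]) (β.comp 1 0 rfl (i ∘ ![0, 2]))
  set B01 := rs _ (inter_comp_le U i ![0, 1]) (β.comp 1 0 rfl (i ∘ ![0, 1]))
  have a1' : A02 = A12 + A01 := by
    have : A12 - A02 + A01 = 0 := a1
    rw [sub_add_eq_add_sub, sub_eq_zero] at this; exact this.symm
  have b1' : B02 = B12 + B01 := by
    have : B12 - B02 + B01 = 0 := b1
    rw [sub_add_eq_add_sub, sub_eq_zero] at this; exact this.symm
  have key := μ.leibniz_zero (inter U i) A01 B12
  rw [a2, b2] at key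
  rw [a1', b1']
  simp only [map_add, map_sub, LinearMap.add_apply, LinearMap.sub_apply] at key ⊢
  rw [Pi.zero_apply, ← key]
  abel

theorem cup_coboundary_left (μ : Contraction F G K 1) (U : ι → Opens X) {α : Tot U F 1}
    {β : Tot U G 1} (hα : α ∈ coboundaries U F 1) (hβ : β ∈ cocycles U G 1) :
    ∃ e : Cech U K 0, cechD U K 0 e = cup μ U 1 1 1 α β := by
  obtain ⟨x, rfl⟩ := hα
  refine ⟨fun i => - μ.pair 0 1 (inter U i) (x.comp 0 0 rfl i) (β.comp 0 1 rfl i), ?_⟩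
  funext i
  have h0 : (totD U F 0 x).comp 0 1 rfl = cechMap U (F.d 0 1) 0 (x.comp 0 0 rfl) := by
    simp [Tot.comp, totD, totDCech, totDCoeff]
  have h1 : (totD U F 0 x).comp 1 0 rfl = cechD U (F.X 0) 0 (x.comp 0 0 rfl) := by
    simp [Tot.comp, totD, totDCech, totDCoeff]
  rw [cechD_zero_apply, cup_one, h0, h1, cechD_zero_apply]
  have b2 := congrFun (mem_cocycles_one hβ).2.1 i
  rw [cechD_zero_apply] at b2
  replace b2 : ((G.d 0 1).app (op (inter U i))).hom (β.comp 1 0 rfl i) = _ := b2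
  change _ = μ.pair 1 0 _ (rs _ _ (((F.d 0 1).app _).hom (x.comp 0 0 rfl _))) _ - _
  rw [← app_rs]
  have key := μ.leibniz_zero (inter U i)
    (rs (F.X 0) (inter_comp_le U i (fun _ => 0)) (x.comp 0 0 rfl (i ∘ fun _ => 0)))
    (β.comp 1 0 rfl i)
  rw [b2] at key
  rw [map_neg, map_neg, μ.natural, μ.natural]
  simp only [map_sub, LinearMap.sub_apply] at key ⊢
  rw [← sub_eq_zero] at key ⊢
  rw [← neg_eq_zero, ← key]
  abel

theorem cup_coboundary_right (μ : Contraction F G K 1) (U : ι → Opens X) {α : Tot U F 1}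
    {β : Tot U G 1} (hα : α ∈ cocycles U F 1) (hβ : β ∈ coboundaries U G 1) :
    ∃ e : Cech U K 0, cechD U K 0 e = cup μ U 1 1 1 α β := by
  obtain ⟨y, rfl⟩ := hβ
  refine ⟨fun i => μ.pair 1 0 (inter U i) (α.comp 0 1 rfl i) (y.comp 0 0 rfl i), ?_⟩
  funext i
  have h0 : (totD U G 0 y).comp 0 1 rfl = cechMap U (G.d 0 1) 0 (y.comp 0 0 rfl) := by
    simp [Tot.comp, totD, totDCech, totDCoeff]
  have h1 : (totD U G 0 y).comp 1 0 rfl = cechD U (G.X 0) 0 (y.comp 0 0 rfl) := by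
    simp [Tot.comp, totD, totDCech, totDCoeff]
  rw [cechD_zero_apply, cup_one, h0, h1, cechD_zero_apply]
  have a2 := congrFun (mem_cocycles_one hα).2.1 i
  rw [cechD_zero_apply] at a2
  replace a2 : ((F.d 0 1).app (op (inter U i))).hom (α.comp 1 0 rfl i) = _ := a2
  change _ = _ - μ.pair 0 1 _ _ (rs _ _ (((G.d 0 1).app _).hom (y.comp 0 0 rfl _)))
  rw [← app_rs]
  have key := μ.leibniz_zero (inter U i) (α.comp 1 0 rfl i)
    (rs (G.X 0) (inter_comp_le U i (fun _ => 1)) (y.comp 0 0 rfl (i ∘ fun _ => 1)))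
  rw [a2] at key
  rw [μ.natural, μ.natural]
  simp only [map_sub, LinearMap.sub_apply] at key ⊢
  rw [← sub_eq_zero] at key ⊢
  rw [← key]
  abel

theorem cup_refTot (μ : Contraction F G K N) {U : ι → Opens X} {W : κ → Opens X} (r : κ → ι)
    (h : ∀ k, W k ≤ U (r k)) (α : Tot U F 1) (β : Tot U G 1) :
    cup μ W 1 1 1 (refTot r h F 1 α) (refTot r h G 1 β) = refCech r h K 1 (cup μ U 1 1 1 α β) := by
  funext i
  simp only [refCech, LinearMap.pi_apply, LinearMap.comp_apply, LinearMap.proj_apply, cup_one,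
    map_sub, μ.natural, rs_rs, refTot, Tot.comp]
  rfl

theorem mkConc_refCech {U : ι → Opens X} {W : κ → Opens X} (r : κ → ι)
    (h : ∀ k, W k ≤ U (r k)) (c : Cech U K 1) :
    mkConc K W (refCech r h K 1 c) = refTot r h (conc K) 1 (mkConc K U c) := by
  funext ⟨⟨p, q⟩, hpq⟩
  replace hpq : p + q = 1 := hpq
  have hpq' : (p = 1 ∧ q = 0) ∨ (p = 0 ∧ q = 1) := by omega
  rcases hpq' with ⟨rfl, rfl⟩ | ⟨rfl, rfl⟩
  · rfl
  · exact Subsingleton.elim (α := ∀ i : Fin 1 → κ, PUnit) _ _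

theorem mkConc_add {U : ι → Opens X} (c c' : Cech U K 1) :
    mkConc K U (c + c') = mkConc K U c + mkConc K U c' := by
  funext ⟨⟨p, q⟩, hpq⟩
  replace hpq : p + q = 1 := hpq
  have hpq' : (p = 1 ∧ q = 0) ∨ (p = 0 ∧ q = 1) := by omega
  rcases hpq' with ⟨rfl, rfl⟩ | ⟨rfl, rfl⟩
  · rfl
  · exact Subsingleton.elim (α := ∀ i : Fin 1 → ι, PUnit) _ _

theorem mkConc_smul {U : ι → Opens X} (a : ℂ) (c : Cech U K 1) :
    mkConc K U (a • c) = a • mkConc K U c := by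
  funext ⟨⟨p, q⟩, hpq⟩
  replace hpq : p + q = 1 := hpq
  have hpq' : (p = 1 ∧ q = 0) ∨ (p = 0 ∧ q = 1) := by omega
  rcases hpq' with ⟨rfl, rfl⟩ | ⟨rfl, rfl⟩
  · rfl
  · exact Subsingleton.elim (α := ∀ i : Fin 1 → ι, PUnit) _ _

/-- The cup product followed by the contraction, on cocycles of degree one. -/
def cocyclePair (μ : Contraction F G K 1) (U : ι → Opens X) :
    cocycles U F 1 →ₗ[ℂ] cocycles U G 1 →ₗ[ℂ] HCov U (conc K) 1 :=
  LinearMap.mk₂ ℂ (fun α β => Submodule.Quotient.mk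
      ⟨mkConc K U (cup μ U 1 1 1 α.1 β.1), mkConc_mem_cocycles (cup_cocycle μ U α.2 β.2)⟩)
    (fun α α' β => congrArg Submodule.Quotient.mk (Subtype.ext (by
      exact (congrArg (mkConc K U) (LinearMap.map_add₂ (cupOne μ U) α.1 α'.1 β.1)).trans (mkConc_add _ _))))
    (fun c α β => congrArg Submodule.Quotient.mk (Subtype.ext (by
      exact (congrArg (mkConc K U) (LinearMap.map_smul₂ (cupOne μ U) c α.1 β.1)).trans (mkConc_smul _ _))))
    (fun α β β' => congrArg Submodule.Quotient.mk (Subtype.ext (by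
      exact (congrArg (mkConc K U) (map_add (cupOne μ U α.1) β.1 β'.1)).trans (mkConc_add _ _))))
    (fun c α β => congrArg Submodule.Quotient.mk (Subtype.ext (by
      exact (congrArg (mkConc K U) (map_smul (cupOne μ U α.1) c β.1)).trans (mkConc_smul _ _))))

/-- The pairing induced by the cup product and the contraction on the Čech hypercohomology of a
family of open sets. -/
def covPair (μ : Contraction F G K 1) (U : ι → Opens X) :
    HCov U F 1 →ₗ[ℂ] HCov U G 1 →ₗ[ℂ] HCov U (conc K) 1 :=
  (Submodule.liftQ _ (LinearMap.flip (Submodule.liftQ _ (cocyclePair μ U) fun α hα => by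
      change cocyclePair μ U α = 0
      ext β
      obtain ⟨e, he⟩ := cup_coboundary_left μ U hα β.2
      exact (Submodule.Quotient.mk_eq_zero _).2 (mkConc_mem_coboundaries e he)))
    fun β hβ => by
      refine LinearMap.ext fun a => ?_
      obtain ⟨α, rfl⟩ := Submodule.Quotient.mk_surjective _ a
      obtain ⟨e, he⟩ := cup_coboundary_right μ U α.2 hβ
      exact (Submodule.Quotient.mk_eq_zero _).2 (mkConc_mem_coboundaries e he)).flip

theorem covPair_refH (μ : Contraction F G K 1) {U : ι → Opens X} {W : κ → Opens X} (r : κ → ι)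
    (h : ∀ k, W k ≤ U (r k)) (a : HCov U F 1) (b : HCov U G 1) :
    covPair μ W (refH r h F 1 a) (refH r h G 1 b) = refH r h (conc K) 1 (covPair μ U a b) := by
  obtain ⟨α, rfl⟩ := Submodule.Quotient.mk_surjective _ a
  obtain ⟨β, rfl⟩ := Submodule.Quotient.mk_surjective _ b
  refine congrArg Submodule.Quotient.mk (Subtype.ext ?_)
  change mkConc K W _ = refTot r h (conc K) 1 (mkConc K U _)
  rw [← mkConc_refCech]
  exact congrArg _ (cup_refTot μ r h α.1 β.1)

theorem refH_refH {V V' V'' : X → Opens X} (F : CochainComplex (Psh X) ℕ) (n : ℕ)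
    (h : ∀ x, V' (id x) ≤ V x) (h' : ∀ x, V'' (id x) ≤ V' x) (h'' : ∀ x, V'' (id x) ≤ V x)
    (a : HCov V F n) :
    refH id h' F n (refH id h F n a) = refH id h'' F n a := by
  obtain ⟨α, rfl⟩ := Submodule.Quotient.mk_surjective _ a
  refine congrArg Submodule.Quotient.mk (Subtype.ext ?_)
  funext p i
  exact rs_rs _ _ _ _

/-- The intersection of two covers indexed by points. -/
def PtCover.meet (V W : PtCover X) : PtCover X := ⟨fun x => V.1 x ⊓ W.1 x, fun x => ⟨V.2 x, W.2 x⟩⟩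

theorem PtCover.le_meet_left (V W : PtCover X) : V ≤ V.meet W := fun _ => inf_le_left

theorem PtCover.le_meet_right (V W : PtCover X) : W ≤ V.meet W := fun _ => inf_le_right

/-- The class in the hypercohomology of a class in the Čech hypercohomology of a cover. -/
def toHyper (F : CochainComplex (Psh X) ℕ) (n : ℕ) (V : PtCover X) : HCov V.1 F n →ₗ[ℂ] Hyper F n :=
  Module.DirectLimit.of ℂ (PtCover X) (fun V : PtCover X => HCov V.1 F n)
    (fun _ _ h => refH id h F n) V

theorem toHyper_refH (F : CochainComplex (Psh X) ℕ) (n : ℕ) {V W : PtCover X} (h : V ≤ W)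
    (a : HCov V.1 F n) : toHyper F n W (refH id h F n a) = toHyper F n V a :=
  Module.DirectLimit.of_f

/-- The pairing of classes living on two covers: both are restricted to the common refinement. -/
def meetPair (μ : Contraction F G K 1) (V W : PtCover X) :
    HCov V.1 F 1 →ₗ[ℂ] HCov W.1 G 1 →ₗ[ℂ] Hyper (conc K) 1 :=
  ((covPair μ (V.meet W).1).compl₁₂ (refH id (PtCover.le_meet_left V W) F 1)
    (refH id (PtCover.le_meet_right V W) G 1)).compr₂ (toHyper (conc K) 1 (V.meet W))

theorem meetPair_eq (μ : Contraction F G K 1) {V W Y : PtCover X} (hV : V ≤ Y) (hW : W ≤ Y)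
    (a : HCov V.1 F 1) (b : HCov W.1 G 1) :
    meetPair μ V W a b =
      toHyper (conc K) 1 Y (covPair μ Y.1 (refH id hV F 1 a) (refH id hW G 1 b)) := by
  have h : V.meet W ≤ Y := fun x => le_inf (hV x) (hW x)
  change toHyper (conc K) 1 (V.meet W) (covPair μ _ _ _) = _
  rw [← toHyper_refH (conc K) 1 h, ← covPair_refH, refH_refH F 1 _ _ hV, refH_refH G 1 _ _ hW]

/-- The pairing `ℍ¹(F) ⊗ ℍ¹(G) ⟶ H¹(X, K)` induced by a contraction `F ⊗ G ⟶ K[-1]`: the cup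
product followed by the map on cohomology induced by the contraction. -/
def hyperPair (μ : Contraction F G K 1) : Hyper F 1 →ₗ[ℂ] Hyper G 1 →ₗ[ℂ] Hyper (conc K) 1 :=
  (Module.DirectLimit.lift ℂ (PtCover X) (fun V : PtCover X => HCov V.1 G 1)
    (fun _ _ h => refH id h G 1)
    (fun W => (Module.DirectLimit.lift ℂ (PtCover X) (fun V : PtCover X => HCov V.1 F 1)
      (fun _ _ h => refH id h F 1) (fun V => meetPair μ V W) (fun V V' h a => by
        ext1 b
        have hV : V ≤ V'.meet W := h.trans (PtCover.le_meet_left V' W)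
        rw [meetPair_eq μ hV (PtCover.le_meet_right V' W),
          meetPair_eq μ (PtCover.le_meet_left V' W) (PtCover.le_meet_right V' W),
          refH_refH F 1 _ _ hV])).flip)
    (fun W W' h b => by
      ext V a
      simp only [LinearMap.comp_apply, LinearMap.flip_apply, Module.DirectLimit.lift_of]
      have hW : W ≤ V.meet W' := h.trans (PtCover.le_meet_right V W')
      rw [meetPair_eq μ (PtCover.le_meet_left V W') hW,
          meetPair_eq μ (PtCover.le_meet_left V W') (PtCover.le_meet_right V W'),
          refH_refH G 1 _ _ hW])).flip

/-! ### Functoriality -/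

/-- The map on total Čech cochains induced by a morphism of complexes. -/
def totMap {F G : CochainComplex (Psh X) ℕ} (φ : F ⟶ G) (U : ι → Opens X) (n : ℕ) :
    Tot U F n →ₗ[ℂ] Tot U G n :=
  LinearMap.pi fun a => cechMap U (φ.f a.1.2) a.1.1 ∘ₗ LinearMap.proj a

theorem totD_totMap {F G : CochainComplex (Psh X) ℕ} (φ : F ⟶ G) (U : ι → Opens X) (n : ℕ)
    (α : Tot U F n) : totD U G n (totMap φ U n α) = totMap φ U (n + 1) (totD U F n α) := by
  funext ⟨⟨p, q⟩, hpq⟩ i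
  have h1 : totDCech U G n p q hpq (totMap φ U n α) i
      = ((φ.f q).app (op (inter U i))).hom (totDCech U F n p q hpq α i) := by
    cases p with
    | zero => simp [totDCech]
    | succ p =>
      simp only [totDCech, totMap, cechD, cechMap, Tot.comp, LinearMap.smul_apply,
        LinearMap.comp_apply, LinearMap.proj_apply, LinearMap.pi_apply, Pi.smul_apply,
        LinearMap.sum_apply, map_smul, map_sum, app_rs]
  have h2 : totDCoeff U G n p q hpq (totMap φ U n α) i
      = ((φ.f q).app (op (inter U i))).hom (totDCoeff U F n p q hpq α i) := by
    cases q with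
    | zero => simp [totDCoeff]
    | succ q =>
      have := congrArg (fun k => (k.app (op (inter U i))).hom (α.comp p q (by omega) i))
        (φ.comm q (q + 1))
      exact this
  simp only [totD, totMap, cechMap, LinearMap.pi_apply, LinearMap.add_apply, Pi.add_apply,
    LinearMap.comp_apply, LinearMap.proj_apply, map_add]
  exact congrArg₂ (· + ·) h1 h2

theorem totMap_mem_cocycles {F G : CochainComplex (Psh X) ℕ} (φ : F ⟶ G) (U : ι → Opens X) (n : ℕ)
    (α : Tot U F n) (hα : α ∈ cocycles U F n) : totMap φ U n α ∈ cocycles U G n := by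
  have : totD U F n α = 0 := hα
  change totD U G n _ = 0
  rw [totD_totMap, this, map_zero]

theorem totMap_mem_coboundaries {F G : CochainComplex (Psh X) ℕ} (φ : F ⟶ G) (U : ι → Opens X)
    (n : ℕ) (α : Tot U F n) (hα : α ∈ coboundaries U F n) :
    totMap φ U n α ∈ coboundaries U G n := by
  cases n with
  | zero =>
    have : α = 0 := hα
    rw [this, map_zero]; exact zero_mem _
  | succ n =>
    obtain ⟨x, rfl⟩ := hα
    exact ⟨totMap φ U n x, totD_totMap φ U n x⟩

/-- The map on Čech hypercohomology induced by a morphism of complexes. -/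
def covMap {F G : CochainComplex (Psh X) ℕ} (φ : F ⟶ G) (U : ι → Opens X) (n : ℕ) :
    HCov U F n →ₗ[ℂ] HCov U G n :=
  Submodule.mapQ _ _ ((totMap φ U n).restrict (totMap_mem_cocycles φ U n)) fun α hα =>
    totMap_mem_coboundaries φ U n α.1 hα

/-- The map on hypercohomology induced by a morphism of complexes. -/
def hyperMap {F G : CochainComplex (Psh X) ℕ} (φ : F ⟶ G) (n : ℕ) :
    Hyper F n →ₗ[ℂ] Hyper G n :=
  Module.DirectLimit.lift ℂ (PtCover X) (fun V : PtCover X => HCov V.1 F n)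
    (fun _ _ h => refH id h F n) (fun V => toHyper G n V ∘ₗ covMap φ V.1 n) (fun V W h a => by
      obtain ⟨α, rfl⟩ := Submodule.Quotient.mk_surjective _ a
      have : covMap φ W.1 n (refH id h F n (Submodule.Quotient.mk α))
          = refH id h G n (covMap φ V.1 n (Submodule.Quotient.mk α)) := by
        refine congrArg Submodule.Quotient.mk (Subtype.ext ?_)
        funext p i
        exact app_rs _ _ _
      change toHyper G n W _ = toHyper G n V _
      rw [this, toHyper_refH])

/-- A commutative square gives a morphism of complexes with terms in degrees `0` and `1`. -/
def twoMap {A B A' B' : Psh X} {f : A ⟶ B} {f' : A' ⟶ B'} (a : A ⟶ A') (b : B ⟶ B')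
    (h : a ≫ f' = f ≫ b) : twoTerm f ⟶ twoTerm f' :=
  CochainComplex.ofHom (fun n => match n with
    | 0 => a
    | 1 => b
    | _ + 2 => 𝟙 _) (fun n => match n with
    | 0 => h
    | 1 => (Limits.comp_zero).trans Limits.zero_comp.symm
    | _ + 2 => (Limits.comp_zero).trans Limits.zero_comp.symm)

/-- A contraction `F ⊗ G ⟶ K[-1]` for complexes with terms in degrees `0` and `1`, from its two
components. -/
def twoContraction {A B A' B' K : Psh X} (f : A ⟶ B) (f' : A' ⟶ B')
    (m₁₀ : ∀ U : Opens X, B.obj (op U) →ₗ[ℂ] A'.obj (op U) →ₗ[ℂ] K.obj (op U))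
    (m₀₁ : ∀ U : Opens X, A.obj (op U) →ₗ[ℂ] B'.obj (op U) →ₗ[ℂ] K.obj (op U))
    (nat₁₀ : ∀ (U V : Opens X) (h : V ≤ U) x y,
      rs K h (m₁₀ U x y) = m₁₀ V (rs B h x) (rs A' h y))
    (nat₀₁ : ∀ (U V : Opens X) (h : V ≤ U) x y,
      rs K h (m₀₁ U x y) = m₀₁ V (rs A h x) (rs B' h y))
    (leib : ∀ (U : Opens X) (x : A.obj (op U)) (y : A'.obj (op U)),
      m₁₀ U ((f.app (op U)).hom x) y + m₀₁ U x ((f'.app (op U)).hom y) = 0) :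
    Contraction (twoTerm f) (twoTerm f') K 1 where
  pair a b U := match a, b with
    | 1, 0 => m₁₀ U
    | 0, 1 => m₀₁ U
    | 0, 0 => 0
    | 0, _ + 2 => 0
    | 1, _ + 1 => 0
    | _ + 2, _ => 0
  degree a b U h := by
    match a, b, h with
    | 1, 0, h => exact absurd rfl h
    | 0, 1, h => exact absurd rfl h
    | 0, 0, _ => rfl
    | 0, _ + 2, _ => rfl
    | 1, _ + 1, _ => rfl
    | _ + 2, _, _ => rfl
  natural a b U V h x y := by
    match a, b with
    | 1, 0 => exact nat₁₀ U V h x y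
    | 0, 1 => exact nat₀₁ U V h x y
    | 0, 0 => exact map_zero _
    | 0, _ + 2 => exact map_zero _
    | 1, _ + 1 => exact map_zero _
    | _ + 2, _ => exact map_zero _
  leibniz a b U h x y := by
    obtain ⟨rfl, rfl⟩ : a = 0 ∧ b = 0 := by omega
    have h1 : (twoTerm f).d 0 (0 + 1) = f := CochainComplex.of_d (twoX A B) (twoD f) 0
    have h2 : (twoTerm f').d 0 (0 + 1) = f' := CochainComplex.of_d (twoX A' B') (twoD f') 0
    rw [h1, h2, pow_zero, one_smul]
    exact leib U x y

end Cech
section Lie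

variable {EG : Type u} [NormedAddCommGroup EG] [NormedSpace ℂ EG]
  {G : Type u} [TopologicalSpace G] [ChartedSpace EG G] [Group G]

/-- The adjoint representation of a complex Lie group on its Lie algebra `T₁G` (whose underlying
vector space is the model space `EG`): `Ad g` is the derivative at `1` of `h ↦ g h g⁻¹`. -/
def Ad (g : G) : EG →L[ℂ] EG :=
  mfderiv 𝓘(ℂ, EG) 𝓘(ℂ, EG) (fun h : G => g * h * g⁻¹) 1

variable (EG G) in
/-- The adjoint representation of the Lie algebra, `ad z x = [z, x]`: the derivative of `Ad`
at `1`. -/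
def ad : EG →L[ℂ] EG →L[ℂ] EG :=
  mfderiv 𝓘(ℂ, EG) 𝓘(ℂ, EG →L[ℂ] EG) (fun g : G => Ad (EG := EG) g) 1

variable [LieGroup 𝓘(ℂ, EG) ω G]

theorem contMDiff_conj : ContMDiff (𝓘(ℂ, EG).prod 𝓘(ℂ, EG)) 𝓘(ℂ, EG) ω
    (fun q : G × G => q.1 * q.2 * q.1⁻¹) :=
  (contMDiff_fst.mul contMDiff_snd).mul contMDiff_fst.inv

theorem hasMFDerivAt_conj (g : G) : HasMFDerivAt 𝓘(ℂ, EG) 𝓘(ℂ, EG) (fun h : G => g * h * g⁻¹) 1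
    (Ad (EG := EG) g) := by
  have : ContMDiff 𝓘(ℂ, EG) 𝓘(ℂ, EG) ω (fun h : G => g * h * g⁻¹) :=
    (contMDiff_const.mul contMDiff_id).mul contMDiff_const
  exact ((this 1).mdifferentiableAt (by simp)).hasMFDerivAt

theorem Ad_one : Ad (EG := EG) (1 : G) = ContinuousLinearMap.id ℂ EG := by
  have h := hasMFDerivAt_conj (EG := EG) (1 : G)
  have h2 : (fun h : G => 1 * h * 1⁻¹) = id := by funext h; simp
  rw [h2] at h
  exact hasMFDerivAt_unique h (hasMFDerivAt_id 1)

theorem Ad_mul (g h : G) : Ad (EG := EG) (g * h) = (Ad g).comp (Ad h) := by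
  have e : h * 1 * h⁻¹ = 1 := by simp
  have h1 : HasMFDerivAt 𝓘(ℂ, EG) 𝓘(ℂ, EG) (fun k : G => g * k * g⁻¹) (h * 1 * h⁻¹)
    (Ad (EG := EG) g) := by rw [e]; exact hasMFDerivAt_conj g
  have h2 := HasMFDerivAt.comp (1 : G) h1 (hasMFDerivAt_conj (EG := EG) h)
  have h3 : ((fun k : G => g * k * g⁻¹) ∘ fun k : G => h * k * h⁻¹)
      = fun k => (g * h) * k * (g * h)⁻¹ := by
    funext k; simp [mul_assoc]
  rw [h3] at h2
  exact hasMFDerivAt_unique (hasMFDerivAt_conj (g * h)) h2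

theorem Ad_inv_comp (g : G) : (Ad (EG := EG) g⁻¹).comp (Ad g) = ContinuousLinearMap.id ℂ EG := by
  rw [← Ad_mul, inv_mul_cancel, Ad_one]

theorem Ad_comp_inv (g : G) : (Ad (EG := EG) g).comp (Ad g⁻¹) = ContinuousLinearMap.id ℂ EG := by
  rw [← Ad_mul, mul_inv_cancel, Ad_one]

theorem mdifferentiableAt_Ad : MDifferentiableAt 𝓘(ℂ, EG) 𝓘(ℂ, EG →L[ℂ] EG)
    (fun g : G => Ad (EG := EG) g) 1 := by
  have : IsManifold 𝓘(ℂ, EG) 1 G := IsManifold.of_le (n := ω) (by simp)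
  have h := ContMDiffAt.mfderiv (n := ω) (m := 1) (x₀ := (1 : G)) (I := 𝓘(ℂ, EG))
    (I' := 𝓘(ℂ, EG)) (fun g h : G => g * h * g⁻¹) (fun _ => 1)
    (contMDiff_conj (EG := EG) (1, 1)) contMDiffAt_const (by simp)
  refine (h.mdifferentiableAt one_ne_zero).congr_of_eventuallyEq (Filter.Eventually.of_forall ?_)
  intro g
  have e : ∀ y : G, y = 1 → y ∈ (chartAt EG ((1 : G) * 1 * 1⁻¹)).source := by
    rintro y rfl
    have : (1 : G) * 1 * 1⁻¹ = 1 := by simp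
    rw [this]; exact mem_chart_source _ _
  have e' : ∀ y : G, y = 1 → ∀ v : EG, (tangentBundleCore 𝓘(ℂ, EG) G).coordChange (achart EG y)
      (achart EG ((1 : G) * 1 * 1⁻¹)) y v = v := by
    rintro y rfl v
    have : (1 : G) * 1 * 1⁻¹ = 1 := by simp
    rw [this]
    exact (tangentBundleCore 𝓘(ℂ, EG) G).coordChange_self _ _ (mem_chart_source _ _) v
  refine Eq.trans ?_ (inTangentCoordinates_eq (I := 𝓘(ℂ, EG)) (I' := 𝓘(ℂ, EG))
    (fun _ : G => (1 : G)) (fun x : G => x * 1 * x⁻¹) (fun x => Ad (EG := EG) x) (x₀ := (1 : G))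
    (x := g) (mem_chart_source _ _) (e _ (by simp))).symm
  ext v
  have h1 := (tangentBundleCore 𝓘(ℂ, EG) G).coordChange_self (achart EG (1 : G)) 1
    (mem_chart_source _ _) v
  exact ((e' _ (by simp) _).trans (congrArg (Ad (EG := EG) g) h1)).symm

theorem hasMFDerivAt_Ad : HasMFDerivAt 𝓘(ℂ, EG) 𝓘(ℂ, EG →L[ℂ] EG)
    (fun g : G => Ad (EG := EG) g) 1 (ad EG G) :=
  mdifferentiableAt_Ad.hasMFDerivAt

/-- The bracket is equivariant under the adjoint action. -/
theorem Ad_ad (g : G) (z x : EG) : Ad g (ad EG G z x) = ad EG G (Ad g z) (Ad g x) := by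
  have e : g * 1 * g⁻¹ = 1 := by simp
  have h1 : HasMFDerivAt 𝓘(ℂ, EG) 𝓘(ℂ, EG →L[ℂ] EG) (fun g : G => Ad (EG := EG) g) (g * 1 * g⁻¹)
    (ad EG G) := by rw [e]; exact hasMFDerivAt_Ad
  have h2 := HasMFDerivAt.comp (1 : G) h1 (hasMFDerivAt_conj (EG := EG) g)
  have h3 := HasMFDerivAt.comp (1 : G)
    ((ContinuousLinearMap.compL ℂ EG EG EG).flip (Ad g)).hasMFDerivAt h2
  have h4 := HasMFDerivAt.comp (1 : G)
    ((ContinuousLinearMap.compL ℂ EG EG EG) (Ad g)).hasMFDerivAt (hasMFDerivAt_Ad (EG := EG))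
  have h5 : (⇑((ContinuousLinearMap.compL ℂ EG EG EG).flip (Ad g)) ∘
      (fun g : G => Ad (EG := EG) g) ∘ fun h => g * h * g⁻¹) =
      (⇑((ContinuousLinearMap.compL ℂ EG EG EG) (Ad g)) ∘ fun g => Ad g) := by
    funext h
    change (Ad (g * h * g⁻¹)).comp (Ad g) = (Ad g).comp (Ad h)
    rw [Ad_mul, Ad_mul, ContinuousLinearMap.comp_assoc, Ad_inv_comp, ContinuousLinearMap.comp_id]
  rw [h5] at h3
  have h6 := hasMFDerivAt_unique h4 h3
  exact congrArg (fun k : EG →L[ℂ] EG →L[ℂ] EG => k z x) h6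

/-- An `Ad`-invariant bilinear form is invariant under the bracket. -/
theorem invariant_ad (B : EG →L[ℂ] EG →L[ℂ] ℂ) (hB : ∀ (g : G) x y, B (Ad g x) (Ad g y) = B x y)
    (z x y : EG) : B (ad EG G z x) y + B x (ad EG G z y) = 0 := by
  have h1 : HasFDerivAt (fun T : EG →L[ℂ] EG => B (T x) (T y))
      ((B.flip (Ad (1 : G) y)).comp (ContinuousLinearMap.apply ℂ EG x)
        + (B (Ad (1 : G) x)).comp (ContinuousLinearMap.apply ℂ EG y)) (Ad (1 : G)) := by
    have := B.hasFDerivAt_of_bilinear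
      (ContinuousLinearMap.apply ℂ EG x).hasFDerivAt
      (ContinuousLinearMap.apply ℂ EG y).hasFDerivAt (x := Ad (EG := EG) (1 : G))
    refine this.congr_fderiv ?_
    ext T
    simp [add_comm]
  have h2 := HasMFDerivAt.comp (1 : G) h1.hasMFDerivAt (hasMFDerivAt_Ad (EG := EG))
  have h3 : ((fun T : EG →L[ℂ] EG => B (T x) (T y)) ∘ fun g : G => Ad g) = fun _ => B x y := by
    funext g; exact hB g x y
  rw [h3] at h2
  have h4 := hasMFDerivAt_unique h2 (hasMFDerivAt_const _ _)
  have h5 := congrArg (fun k : EG →L[ℂ] ℂ => k z) h4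
  rw [Ad_one] at h5
  exact h5

end Lie
/-! ### Presheaves of functions extended by zero -/

section MkPsh

variable {X : Type u} [TopologicalSpace X] {A : Type u} {T : A → Type w} [∀ a, AddCommGroup (T a)] [∀ a, Module ℂ (T a)]

open Classical in
/-- Restriction to the points over `U`, followed by extension by zero. -/
def cut (π : A → X) (U : Opens X) : (∀ a, T a) →ₗ[ℂ] (∀ a, T a) where
  toFun f a := if π a ∈ U then f a else 0
  map_add' f g := by funext a; by_cases h : π a ∈ U <;> simp [h]
  map_smul' c f := by funext a; by_cases h : π a ∈ U <;> simp [h]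

theorem cut_of_mem (π : A → X) (U : Opens X) (f : ∀ a, T a) (a : A) (h : π a ∈ U) :
    cut π U f a = f a := by simp [cut, h]

theorem cut_of_notMem (π : A → X) (U : Opens X) (f : ∀ a, T a) (a : A) (h : π a ∉ U) :
    cut π U f a = 0 := by simp [cut, h]

/-- The presheaf on `X` whose sections over `U` are the given functions supported over `U`, with
restriction the extension by zero of the restricted function. -/
def mkPsh (π : A → X) (M : Opens X → Submodule ℂ (∀ a, T a))
    (hsupp : ∀ U, ∀ f ∈ M U, ∀ a, π a ∉ U → f a = 0)
    (hres : ∀ U V : Opens X, V ≤ U → ∀ f ∈ M U, cut π V f ∈ M V) :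
    (Opens X)ᵒᵖ ⥤ ModuleCat.{max u w} ℂ where
  obj U := ModuleCat.of ℂ (M U.unop)
  map {U V} h := ModuleCat.ofHom ((cut π V.unop).restrict (hres U.unop V.unop (leOfHom h.unop)))
  map_id U := by
    refine ModuleCat.hom_ext (LinearMap.ext fun f => Subtype.ext (funext fun a => ?_))
    by_cases h : π a ∈ U.unop
    · exact cut_of_mem _ _ _ _ h
    · exact (cut_of_notMem _ _ _ _ h).trans (hsupp _ _ f.2 _ h).symm
  map_comp {U V W} h k := by
    refine ModuleCat.hom_ext (LinearMap.ext fun f => Subtype.ext (funext fun a => ?_))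
    by_cases hW : π a ∈ W.unop
    · have hV : π a ∈ V.unop := leOfHom k.unop hW
      exact (cut_of_mem _ _ _ _ hW).trans
        ((cut_of_mem _ _ _ _ hW).trans (cut_of_mem _ _ _ _ hV)).symm
    · exact (cut_of_notMem _ _ _ _ hW).trans (cut_of_notMem _ _ _ _ hW).symm

end MkPsh

section Geometry

variable {X : Type u} [TopologicalSpace X] [ChartedSpace ℂ X]

/-- The centred coordinate `z_x(y) = φ_x(y) - φ_x(x)`, with `φ_x` the preferred chart at `x`. -/
def coordAt (x y : X) : ℂ := chartAt ℂ x y - chartAt ℂ x x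

/-- The differential `dz_x` at the point `y`. -/
def dcoordAt (x y : X) : TangentSpace 𝓘(ℂ) y →L[ℂ] ℂ := mfderiv 𝓘(ℂ) 𝓘(ℂ) (chartAt ℂ x) y

/-- The identification of the tangent spaces at two equal points. -/
def tangentCast {x y : X} (h : x = y) : TangentSpace 𝓘(ℂ) x →L[ℂ] TangentSpace 𝓘(ℂ) y :=
  h ▸ ContinuousLinearMap.id ℂ _

theorem tangentCast_apply {α : Type*} (F : ∀ y : X, TangentSpace 𝓘(ℂ) y → α) {x y : X} (h : x = y)
    (v : TangentSpace 𝓘(ℂ) x) : F y (tangentCast h v) = F x v := by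
  subst h; rfl

/-! ### The canonical sheaf -/

/-- Sections of the canonical bundle `K_X` over `U`: holomorphic `1`-forms on `U`, i.e. forms which
are locally `g dz` with `g` holomorphic. A form on `U` is encoded by its extension by zero. -/
def canonSec (U : Opens X) : Submodule ℂ (∀ x : X, TangentSpace 𝓘(ℂ) x →L[ℂ] ℂ) where
  carrier := {η | (∀ x, x ∉ U → η x = 0) ∧
    ∀ x ∈ U, ∃ W : Opens X, x ∈ W ∧ ∃ g : X → ℂ, ContMDiffOn 𝓘(ℂ) 𝓘(ℂ) ω g W ∧
      ∀ y ∈ W, η y = (dcoordAt x y).smulRight (g y)}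
  zero_mem' := ⟨fun _ _ => rfl, fun x _ => ⟨⊤, trivial, 0, contMDiffOn_const, fun y _ => by
    exact (ContinuousLinearMap.ext fun v => by simp)⟩⟩
  add_mem' := by
    rintro η η' ⟨h1, h2⟩ ⟨h1', h2'⟩
    refine ⟨fun x hx => by simp [h1 x hx, h1' x hx], fun x hx => ?_⟩
    obtain ⟨W, hW, g, hg, e⟩ := h2 x hx
    obtain ⟨W', hW', g', hg', e'⟩ := h2' x hx
    refine ⟨W ⊓ W', ⟨hW, hW'⟩, g + g', (hg.mono fun y hy => hy.1).add (hg'.mono fun y hy => hy.2),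
      fun y hy => ?_⟩
    rw [Pi.add_apply, e y hy.1, e' y hy.2]
    refine ContinuousLinearMap.ext fun v => ?_
    simp [mul_add]
  smul_mem' := by
    rintro c η ⟨h1, h2⟩
    refine ⟨fun x hx => by simp [h1 x hx], fun x hx => ?_⟩
    obtain ⟨W, hW, g, hg, e⟩ := h2 x hx
    refine ⟨W, hW, fun y => c • g y, (c • ContinuousLinearMap.id ℂ ℂ).contMDiff.comp_contMDiffOn hg, fun y hy => ?_⟩
    rw [Pi.smul_apply, e y hy]
    refine ContinuousLinearMap.ext fun v => ?_
    simp; ring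

theorem cut_canonSec (U V : Opens X) (hVU : V ≤ U) :
    ∀ f ∈ canonSec U, cut id V f ∈ canonSec V := by
  rintro f ⟨-, h2⟩
  refine ⟨fun x hx => cut_of_notMem id V f x hx, fun x hx => ?_⟩
  obtain ⟨W, hW, g, hg, e⟩ := h2 x (hVU hx)
  exact ⟨W ⊓ V, ⟨hW, hx⟩, g, hg.mono fun y hy => hy.1, fun y hy =>
    (cut_of_mem id V f y hy.2).trans (e y hy.1)⟩

variable (X) in
/-- The canonical sheaf `K_X`. -/
def canonPsh : Psh X := mkPsh id canonSec (fun _ _ hf => hf.1) cut_canonSec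

/-! ### Principal bundles and the sheaves associated with them -/

variable {EG : Type u} [NormedAddCommGroup EG] [NormedSpace ℂ EG]
  {G : Type u} [TopologicalSpace G] [ChartedSpace EG G] [Group G]
  {EP : Type u} [NormedAddCommGroup EP] [NormedSpace ℂ EP]
  {P : Type u} [TopologicalSpace P] [ChartedSpace EP P]

variable (EG G EP P X) in
/-- A holomorphic principal `G`-bundle `P ⟶ X`: a holomorphic map and a holomorphic right action
along its fibres, locally isomorphic over `X` to `U × G`. The local trivialization
`(y, g) ↦ σ(y) g` is given by a holomorphic section `σ` over `U`; its inverse is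
`p ↦ (proj p, γ p)`. -/
structure HolPrincipalBundle where
  proj : P → X
  act : P → G → P
  act_one : ∀ p, act p 1 = p
  act_mul : ∀ p g h, act p (g * h) = act (act p g) h
  proj_act : ∀ p g, proj (act p g) = proj p
  contMDiff_proj : ContMDiff 𝓘(ℂ, EP) 𝓘(ℂ) ω proj
  contMDiff_act : ContMDiff (𝓘(ℂ, EP).prod 𝓘(ℂ, EG)) 𝓘(ℂ, EP) ω fun q : P × G => act q.1 q.2
  locallyTrivial : ∀ x : X, ∃ U : Opens X, x ∈ U ∧ ∃ (σ : X → P) (γ : P → G),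
    ContMDiffOn 𝓘(ℂ) 𝓘(ℂ, EP) ω σ U ∧
    ContMDiffOn 𝓘(ℂ, EP) 𝓘(ℂ, EG) ω γ (proj ⁻¹' U) ∧
    (∀ y ∈ U, proj (σ y) = y) ∧
    (∀ p, proj p ∈ U → act (σ (proj p)) (γ p) = p) ∧
    (∀ y ∈ U, ∀ g, γ (act (σ y) g) = g)

variable (Q : HolPrincipalBundle X EG G EP P)
  {V : Type w} [NormedAddCommGroup V] [NormedSpace ℂ V]

/-- Sections over `U` of the sheaf `P(V)(E) = P(V) ⊗ O_X(E)`, for a representation `ρ` of `G` on `V`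
and a divisor `E` on `X`. A section of the associated bundle `P(V) = P ×^G V` is an equivariant
function `P → V`, `f (p g) = ρ(g⁻¹) f(p)`. A section of `P(V)(E)` is such a function `f`, defined
away from the points `x` with `E x > 0`, which near each `x ∈ U` is of the form `z^{-E x} g` with
`z` a coordinate centred at `x` and `g` holomorphic. It is encoded by its extension by zero. -/
def assocSec (ρ : G → V →L[ℂ] V) (E : X → ℤ) (U : Opens X) : Submodule ℂ (P → V) where
  carrier := {f | (∀ p, ¬ (Q.proj p ∈ U ∧ E (Q.proj p) ≤ 0) → f p = 0) ∧
    (∀ p g, f (Q.act p g) = ρ g⁻¹ (f p)) ∧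
    ∀ x ∈ U, ∃ W : Opens X, x ∈ W ∧ ∃ g : P → V,
      ContMDiffOn 𝓘(ℂ, EP) 𝓘(ℂ, V) ω g (Q.proj ⁻¹' W) ∧
      ∀ p, Q.proj p ∈ W → E (Q.proj p) ≤ 0 → f p = coordAt x (Q.proj p) ^ (-E x) • g p}
  zero_mem' := ⟨fun _ _ => rfl, fun _ _ => by simp, fun x _ => ⟨⊤, trivial, 0, contMDiffOn_const,
    fun p _ _ => by simp⟩⟩
  add_mem' := by
    rintro f f' ⟨h1, h2, h3⟩ ⟨h1', h2', h3'⟩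
    refine ⟨fun p hp => by simp [h1 p hp, h1' p hp], fun p g => by simp [h2, h2'], fun x hx => ?_⟩
    obtain ⟨W, hW, g, hg, e⟩ := h3 x hx
    obtain ⟨W', hW', g', hg', e'⟩ := h3' x hx
    refine ⟨W ⊓ W', ⟨hW, hW'⟩, g + g', (hg.mono fun p hp => hp.1).add (hg'.mono fun p hp => hp.2),
      fun p hp hE => ?_⟩
    rw [Pi.add_apply, e p hp.1 hE, e' p hp.2 hE, Pi.add_apply, smul_add]
  smul_mem' := by
    rintro c f ⟨h1, h2, h3⟩
    refine ⟨fun p hp => by simp [h1 p hp], fun p g => by simp [h2], fun x hx => ?_⟩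
    obtain ⟨W, hW, g, hg, e⟩ := h3 x hx
    refine ⟨W, hW, fun p => c • g p, (c • ContinuousLinearMap.id ℂ V).contMDiff.comp_contMDiffOn hg, fun p hp hE => ?_⟩
    rw [Pi.smul_apply, e p hp hE, smul_comm]

/-- Sections over `U` of the sheaf `P(V) ⊗ K_X(E)`: equivariant functions `f` on `P` with
`f p ∈ Hom(T_{π p} X, V)`, which near each `x ∈ U` are of the form `z^{-E x} g dz` with `g`
holomorphic. -/
def assocForm (ρ : G → V →L[ℂ] V) (E : X → ℤ) (U : Opens X) :
    Submodule ℂ (∀ p : P, TangentSpace 𝓘(ℂ) (Q.proj p) →L[ℂ] V) where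
  carrier := {f | (∀ p, ¬ (Q.proj p ∈ U ∧ E (Q.proj p) ≤ 0) → f p = 0) ∧
    (∀ p g v, f (Q.act p g) (tangentCast (Q.proj_act p g).symm v) = ρ g⁻¹ (f p v)) ∧
    ∀ x ∈ U, ∃ W : Opens X, x ∈ W ∧ ∃ g : P → V,
      ContMDiffOn 𝓘(ℂ, EP) 𝓘(ℂ, V) ω g (Q.proj ⁻¹' W) ∧
      ∀ p, Q.proj p ∈ W → E (Q.proj p) ≤ 0 →
        f p = (dcoordAt x (Q.proj p)).smulRight (coordAt x (Q.proj p) ^ (-E x) • g p)}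
  zero_mem' := ⟨fun _ _ => rfl, fun _ _ _ => by simp, fun x _ => ⟨⊤, trivial, 0, contMDiffOn_const,
    fun p _ _ => by exact (ContinuousLinearMap.ext fun v => by simp)⟩⟩
  add_mem' := by
    rintro f f' ⟨h1, h2, h3⟩ ⟨h1', h2', h3'⟩
    refine ⟨fun p hp => by simp [h1 p hp, h1' p hp], fun p g v => by simp [h2, h2'],
      fun x hx => ?_⟩
    obtain ⟨W, hW, g, hg, e⟩ := h3 x hx
    obtain ⟨W', hW', g', hg', e'⟩ := h3' x hx
    refine ⟨W ⊓ W', ⟨hW, hW'⟩, g + g', (hg.mono fun p hp => hp.1).add (hg'.mono fun p hp => hp.2),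
      fun p hp hE => ?_⟩
    rw [Pi.add_apply, e p hp.1 hE, e' p hp.2 hE]
    refine ContinuousLinearMap.ext fun v => ?_
    simp
  smul_mem' := by
    rintro c f ⟨h1, h2, h3⟩
    refine ⟨fun p hp => by simp [h1 p hp], fun p g v => by simp [h2], fun x hx => ?_⟩
    obtain ⟨W, hW, g, hg, e⟩ := h3 x hx
    refine ⟨W, hW, fun p => c • g p, (c • ContinuousLinearMap.id ℂ V).contMDiff.comp_contMDiffOn hg, fun p hp hE => ?_⟩
    rw [Pi.smul_apply, e p hp hE]
    refine ContinuousLinearMap.ext fun v => ?_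
    simp only [smul_apply, ContinuousLinearMap.smulRight_apply]
    module

theorem cut_assocSec (ρ : G → V →L[ℂ] V) (E : X → ℤ) (U U' : Opens X) (hle : U' ≤ U) :
    ∀ f ∈ assocSec Q ρ E U, cut Q.proj U' f ∈ assocSec Q ρ E U' := by
  rintro f ⟨h1, h2, h3⟩
  refine ⟨fun p hp => ?_, fun p g => ?_, fun x hx => ?_⟩
  · by_cases h : Q.proj p ∈ U'
    · exact (cut_of_mem _ _ _ _ h).trans (h1 p fun h' => hp ⟨h, h'.2⟩)
    · exact cut_of_notMem _ _ _ _ h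
  · by_cases h : Q.proj p ∈ U'
    · rw [cut_of_mem _ _ _ _ h, cut_of_mem _ _ _ _ (by rwa [Q.proj_act]), h2]
    · rw [cut_of_notMem _ _ _ _ h, cut_of_notMem _ _ _ _ (by rwa [Q.proj_act]), map_zero]
  · obtain ⟨W, hW, g, hg, e⟩ := h3 x (hle hx)
    exact ⟨W ⊓ U', ⟨hW, hx⟩, g, hg.mono fun y hy => hy.1, fun p hp hE =>
      (cut_of_mem _ _ _ _ hp.2).trans (e p hp.1 hE)⟩

theorem cut_assocForm (ρ : G → V →L[ℂ] V) (E : X → ℤ) (U U' : Opens X) (hle : U' ≤ U) :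
    ∀ f ∈ assocForm Q ρ E U, cut Q.proj U' f ∈ assocForm Q ρ E U' := by
  rintro f ⟨h1, h2, h3⟩
  refine ⟨fun p hp => ?_, fun p g v => ?_, fun x hx => ?_⟩
  · by_cases h : Q.proj p ∈ U'
    · exact (cut_of_mem _ _ _ _ h).trans (h1 p fun h' => hp ⟨h, h'.2⟩)
    · exact cut_of_notMem _ _ _ _ h
  · by_cases h : Q.proj p ∈ U'
    · rw [cut_of_mem _ _ _ _ h, cut_of_mem _ _ _ _ (by rwa [Q.proj_act]), h2]
    · rw [cut_of_notMem _ _ _ _ h, cut_of_notMem _ _ _ _ (by rwa [Q.proj_act])]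
      simp
  · obtain ⟨W, hW, g, hg, e⟩ := h3 x (hle hx)
    exact ⟨W ⊓ U', ⟨hW, hx⟩, g, hg.mono fun y hy => hy.1, fun p hp hE =>
      (cut_of_mem _ _ _ _ hp.2).trans (e p hp.1 hE)⟩

/-- The sheaf `P(V)(E)`. -/
def assocSecPsh {V : Type u} [NormedAddCommGroup V] [NormedSpace ℂ V] (ρ : G → V →L[ℂ] V)
    (E : X → ℤ) : Psh X :=
  mkPsh Q.proj (assocSec Q ρ E) (fun _ _ hf p hp => hf.1 p fun h => hp h.1) (cut_assocSec Q ρ E)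

/-- The sheaf `P(V) ⊗ K_X(E)`. -/
def assocFormPsh {V : Type u} [NormedAddCommGroup V] [NormedSpace ℂ V] (ρ : G → V →L[ℂ] V)
    (E : X → ℤ) : Psh X :=
  mkPsh Q.proj (assocForm Q ρ E) (fun _ _ hf p hp => hf.1 p fun h => hp h.1) (cut_assocForm Q ρ E)

/-- The value at `p` of a section of `P(V)(E)`, viewed as a function on `P`. -/
def secVal {Q : HolPrincipalBundle X EG G EP P} {V : Type u} [NormedAddCommGroup V]
    [NormedSpace ℂ V] {ρ : G → V →L[ℂ] V} {E : X → ℤ} {U : Opens X}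
    (f : (assocSecPsh Q ρ E).obj (op U)) (p : P) : V :=
  (show assocSec Q ρ E U from f).1 p

/-- The value at `p` of a section of `P(V) ⊗ K_X(E)`, viewed as a function on `P`. -/
def formVal {Q : HolPrincipalBundle X EG G EP P} {V : Type u} [NormedAddCommGroup V]
    [NormedSpace ℂ V] {ρ : G → V →L[ℂ] V} {E : X → ℤ} {U : Opens X}
    (f : (assocFormPsh Q ρ E).obj (op U)) (p : P) : TangentSpace 𝓘(ℂ) (Q.proj p) →L[ℂ] V :=
  (show assocForm Q ρ E U from f).1 p

/-- The value at `x` of a section of the canonical sheaf. -/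
def canonVal {U : Opens X} (η : (canonPsh X).obj (op U)) (x : X) : TangentSpace 𝓘(ℂ) x →L[ℂ] ℂ :=
  (show canonSec U from η).1 x

/-- A point of the fibre of `P` over `x`. -/
def HolPrincipalBundle.pt (x : X) : P := (Q.locallyTrivial x).choose_spec.2.choose x

theorem HolPrincipalBundle.proj_pt (x : X) : Q.proj (Q.pt x) = x := by
  obtain ⟨γ, -, -, h, -⟩ := (Q.locallyTrivial x).choose_spec.2.choose_spec
  exact h x (Q.locallyTrivial x).choose_spec.1

theorem HolPrincipalBundle.exists_act {p q : P} (h : Q.proj p = Q.proj q) :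
    ∃ g, Q.act p g = q := by
  obtain ⟨U, hU, σ, γ, -, -, -, h2, -⟩ := Q.locallyTrivial (Q.proj p)
  refine ⟨(γ p)⁻¹ * γ q, ?_⟩
  have e1 := h2 p hU
  have e2 := h2 q (h ▸ hU)
  rw [Q.act_mul]
  conv_lhs => rw [← e1]
  rw [← Q.act_mul (σ (Q.proj p)), e1, mul_inv_cancel, Q.act_one, h, e2]

/-! ### Products -/

theorem neBot_punctured (x : X) : (𝓝[≠] x).NeBot := by
  by_contra h
  have h1 : 𝓝[≠] x = ⊥ := Filter.not_neBot.1 h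
  have h2 : IsOpen ({x} : Set X) := isOpen_singleton_iff_punctured_nhds x |>.2 h1
  have h3 := (chartAt ℂ x).isOpen_image_of_subset_source h2
    (Set.singleton_subset_iff.2 (mem_chart_source ℂ x))
  rw [Set.image_singleton] at h3
  exact not_isOpen_singleton _ h3

theorem dcoordAt_ne_zero [IsManifold 𝓘(ℂ) ω X] {x y : X} (hy : y ∈ (chartAt ℂ x).source) :
    dcoordAt x y ≠ 0 := by
  have : IsManifold 𝓘(ℂ) 1 X := IsManifold.of_le (n := ω) (by simp)
  have h := isInvertible_mfderiv_extChartAt (I := 𝓘(ℂ)) (x := x) (y := y) (by simpa using hy)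
  obtain ⟨e, he⟩ := h
  intro h0
  have hv : ∀ v, e v = (0 : ℂ) := fun v =>
    congrArg (fun k : TangentSpace 𝓘(ℂ) y →L[ℂ] ℂ => k v) (he.trans h0)
  exact (one_ne_zero : (1 : ℂ) ≠ 0) ((e.apply_symm_apply (1 : ℂ)).symm.trans (hv _))

theorem coordAt_ne_zero {x y : X} (hy : y ∈ (chartAt ℂ x).source) (h : y ≠ x) :
    coordAt x y ≠ 0 := fun h0 =>
  h ((chartAt ℂ x).injOn hy (mem_chart_source ℂ x) (sub_eq_zero.1 h0))

variable [T2Space X]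

theorem eq_of_off_finite {Y : Type*} [TopologicalSpace Y] [T2Space Y] {g g' : P → Y} {p : P}
    (hg : ContinuousAt g p) (hg' : ContinuousAt g' p) {S : Set X} (hS : S.Finite) (W : Opens X)
    (hp : Q.proj p ∈ W)
    (h : ∀ q, Q.proj q ∈ W → Q.proj q ≠ Q.proj p → Q.proj q ∉ S → g q = g' q) : g p = g' p := by
  obtain ⟨U, hU, σ, γ, hσ, -, h1, h2, -⟩ := Q.locallyTrivial (Q.proj p)
  have := neBot_punctured (Q.proj p)
  have hcσ : ContinuousAt σ (Q.proj p) := (hσ.continuousOn).continuousAt (U.2.mem_nhds hU)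
  have hca : Continuous fun q : P × G => Q.act q.1 q.2 := Q.contMDiff_act.continuous
  have hc : ContinuousAt (fun y => Q.act (σ y) (γ p)) (Q.proj p) :=
    hca.continuousAt.comp (hcσ.prodMk continuousAt_const)
  have ht : Filter.Tendsto (fun y => Q.act (σ y) (γ p)) (𝓝[≠] (Q.proj p)) (𝓝 p) := by
    have := hc.tendsto
    rw [h2 p hU] at this
    exact this.mono_left nhdsWithin_le_nhds
  have hS' : (S \ {Q.proj p})ᶜ ∈ 𝓝 (Q.proj p) :=
    ((hS.subset Set.sdiff_subset).isClosed.isOpen_compl).mem_nhds (by simp)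
  have he : ∀ᶠ y in 𝓝[≠] (Q.proj p), g (Q.act (σ y) (γ p)) = g' (Q.act (σ y) (γ p)) := by
    filter_upwards [self_mem_nhdsWithin, mem_nhdsWithin_of_mem_nhds hS',
      mem_nhdsWithin_of_mem_nhds (W.2.mem_nhds hp), mem_nhdsWithin_of_mem_nhds (U.2.mem_nhds hU)]
      with y y1 y2 y3 y4
    have e : Q.proj (Q.act (σ y) (γ p)) = y := (Q.proj_act _ _).trans (h1 y y4)
    refine h _ (by rw [e]; exact y3) (by rw [e]; exact y1) (by
      rw [e]; exact fun hy => y2 ⟨hy, y1⟩)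
  exact tendsto_nhds_unique ((hg.tendsto.comp ht).congr' he) (hg'.tendsto.comp ht)

/-- Sections of `P(V) ⊗ K_X(E)` which agree away from finitely many fibres are equal. -/
theorem assocForm_ext (ρ : G → V →L[ℂ] V) (E : X → ℤ) {U : Opens X} {f f' : assocForm Q ρ E U}
    {S : Set X} (hS : S.Finite) (hE : {x | E x ≠ 0}.Finite) [IsManifold 𝓘(ℂ) ω X]
    (h : ∀ p, Q.proj p ∈ U → Q.proj p ∉ S → f.1 p = f'.1 p) : f = f' := by
  suffices H : ∀ f : assocForm Q ρ E U, (∀ p, Q.proj p ∈ U → Q.proj p ∉ S → f.1 p = 0) → f = 0 from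
    sub_eq_zero.1 (H (f - f') fun p h1 h2 => sub_eq_zero.2 (h p h1 h2))
  clear h f f'
  intro f h
  refine Subtype.ext (funext fun p => ?_)
  change f.1 p = 0
  by_cases hp : Q.proj p ∈ U ∧ E (Q.proj p) ≤ 0
  · obtain ⟨W, hW, g, hg, e⟩ := f.2.2.2 _ hp.1
    have hcg : ContinuousAt g p := hg.continuousOn.continuousAt
      ((W.2.preimage Q.contMDiff_proj.continuous).mem_nhds hW)
    have hg0 : g p = 0 := by
      refine eq_of_off_finite Q hcg (continuousAt_const (y := (0 : V))) (hS.union hE)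
        (U ⊓ W ⊓ ⟨(chartAt ℂ (Q.proj p)).source, (chartAt ℂ (Q.proj p)).open_source⟩)
        ⟨⟨hp.1, hW⟩, mem_chart_source ℂ _⟩ ?_
      rintro q ⟨⟨q1, q2⟩, q3⟩ q4 q5
      have hE0 : E (Q.proj q) = 0 := by_contra fun hh => q5 (Or.inr hh)
      have h0 := (e q q2 hE0.le).symm.trans (h q q1 fun hh => q5 (Or.inl hh))
      obtain ⟨v, hv⟩ := DFunLike.ne_iff.1 (dcoordAt_ne_zero q3)
      have h1 := congrArg (fun k => k v) h0
      simp only [ContinuousLinearMap.smulRight_apply, zero_apply, smul_eq_zero] at h1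
      rcases h1 with h1 | h1 | h1
      · exact absurd h1 hv
      · exact absurd h1 (zpow_ne_zero _ (coordAt_ne_zero q3 q4))
      · exact h1
    rw [e p hW hp.2, hg0, smul_zero]
    exact ContinuousLinearMap.ext fun v => smul_zero _
  · exact f.2.1 p hp

end Geometry

section Product

variable {X : Type u} [TopologicalSpace X] [ChartedSpace ℂ X]
  {EG : Type u} [NormedAddCommGroup EG] [NormedSpace ℂ EG]
  {G : Type u} [TopologicalSpace G] [ChartedSpace EG G] [Group G]
  {EP : Type u} [NormedAddCommGroup EP] [NormedSpace ℂ EP]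
  {P : Type u} [TopologicalSpace P] [ChartedSpace EP P]
  (Q : HolPrincipalBundle X EG G EP P)
  [T2Space X]

theorem assocForm_germ_equivariant {V : Type*} [NormedAddCommGroup V] [NormedSpace ℂ V]
    [IsManifold 𝓘(ℂ) ω X] {ρ : G → V →L[ℂ] V} {E : X → ℤ} {U W : Opens X} (f : assocForm Q ρ E U)
    (hE : {x | E x ≠ 0}.Finite) {g : P → V}
    (hg : ContMDiffOn 𝓘(ℂ, EP) 𝓘(ℂ, V) ω g (Q.proj ⁻¹' W)) {p : P} (hp : Q.proj p ∈ W)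
    (e : ∀ q, Q.proj q ∈ W → E (Q.proj q) ≤ 0 → f.1 q = (dcoordAt (Q.proj p) (Q.proj q)).smulRight
      (coordAt (Q.proj p) (Q.proj q) ^ (-E (Q.proj p)) • g q)) (a : G) :
    g (Q.act p a) = ρ a⁻¹ (g p) := by
  have hopen : IsOpen (Q.proj ⁻¹' W) := W.2.preimage Q.contMDiff_proj.continuous
  have hca : Continuous fun q : P => Q.act q a :=
    Q.contMDiff_act.continuous.comp (Continuous.prodMk continuous_id continuous_const)
  have c1 : ContinuousAt (fun q => g (Q.act q a)) p :=
    ContinuousAt.comp (f := fun q => Q.act q a)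
      (hg.continuousOn.continuousAt (hopen.mem_nhds (by
        rw [Set.mem_preimage, Q.proj_act]; exact hp))) hca.continuousAt
  have c2 : ContinuousAt (fun q => ρ a⁻¹ (g q)) p :=
    (ρ a⁻¹).continuous.continuousAt.comp (hg.continuousOn.continuousAt (hopen.mem_nhds hp))
  refine eq_of_off_finite Q c1 c2 hE
    (W ⊓ ⟨(chartAt ℂ (Q.proj p)).source, (chartAt ℂ (Q.proj p)).open_source⟩)
    ⟨hp, mem_chart_source ℂ _⟩ ?_
  rintro q ⟨q2, q3⟩ q4 q5
  have hE0 : E (Q.proj q) = 0 := by_contra fun hh => q5 hh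
  obtain ⟨v, hv⟩ := DFunLike.ne_iff.1 (dcoordAt_ne_zero q3)
  have h1 := f.2.2.1 q a v
  rw [e q q2 hE0.le, e (Q.act q a) (by rw [Q.proj_act]; exact q2) (by rw [Q.proj_act]; exact hE0.le),
    tangentCast_apply (fun y v => ((dcoordAt (Q.proj p) y).smulRight
      (coordAt (Q.proj p) y ^ (-E (Q.proj p)) • g (Q.act q a))) v)] at h1
  simp only [ContinuousLinearMap.smulRight_apply, map_smul] at h1
  exact smul_right_injective V (zpow_ne_zero _ (coordAt_ne_zero q3 q4))
    (smul_right_injective V hv h1)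

theorem assocSec_germ_equivariant {V : Type*} [NormedAddCommGroup V] [NormedSpace ℂ V]
    {ρ : G → V →L[ℂ] V} {E : X → ℤ} {U W : Opens X} (f : assocSec Q ρ E U)
    (hE : {x | E x ≠ 0}.Finite) {g : P → V}
    (hg : ContMDiffOn 𝓘(ℂ, EP) 𝓘(ℂ, V) ω g (Q.proj ⁻¹' W)) {p : P} (hp : Q.proj p ∈ W)
    (e : ∀ q, Q.proj q ∈ W → E (Q.proj q) ≤ 0 →
      f.1 q = coordAt (Q.proj p) (Q.proj q) ^ (-E (Q.proj p)) • g q) (a : G) :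
    g (Q.act p a) = ρ a⁻¹ (g p) := by
  have hopen : IsOpen (Q.proj ⁻¹' W) := W.2.preimage Q.contMDiff_proj.continuous
  have hca : Continuous fun q : P => Q.act q a :=
    Q.contMDiff_act.continuous.comp (Continuous.prodMk continuous_id continuous_const)
  have c1 : ContinuousAt (fun q => g (Q.act q a)) p :=
    ContinuousAt.comp (f := fun q => Q.act q a)
      (hg.continuousOn.continuousAt (hopen.mem_nhds (by
        rw [Set.mem_preimage, Q.proj_act]; exact hp))) hca.continuousAt
  have c2 : ContinuousAt (fun q => ρ a⁻¹ (g q)) p :=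
    (ρ a⁻¹).continuous.continuousAt.comp (hg.continuousOn.continuousAt (hopen.mem_nhds hp))
  refine eq_of_off_finite Q c1 c2 hE
    (W ⊓ ⟨(chartAt ℂ (Q.proj p)).source, (chartAt ℂ (Q.proj p)).open_source⟩)
    ⟨hp, mem_chart_source ℂ _⟩ ?_
  rintro q ⟨q2, q3⟩ q4 q5
  have hE0 : E (Q.proj q) = 0 := by_contra fun hh => q5 hh
  have h1 := f.2.2.1 q a
  rw [e q q2 hE0.le, e (Q.act q a) (by rw [Q.proj_act]; exact q2) (by rw [Q.proj_act]; exact hE0.le),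
    Q.proj_act] at h1
  simp only [map_smul] at h1
  exact smul_right_injective V (zpow_ne_zero _ (coordAt_ne_zero q3 q4)) h1

section

variable {V₁ V₂ V₃ : Type*} [NormedAddCommGroup V₁] [NormedSpace ℂ V₁]
  [NormedAddCommGroup V₂] [NormedSpace ℂ V₂] [NormedAddCommGroup V₃] [NormedSpace ℂ V₃]
  {ρ₁ : G → V₁ →L[ℂ] V₁} {ρ₂ : G → V₂ →L[ℂ] V₂} {ρ₃ : G → V₃ →L[ℂ] V₃} {E₁ E₂ E₃ : X → ℤ}
  [IsManifold 𝓘(ℂ) ω X]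

open Classical in
theorem exists_prod (b : V₁ →L[ℂ] V₂ →L[ℂ] V₃)
    (hb : ∀ g x y, ρ₃ g (b x y) = b (ρ₁ g x) (ρ₂ g y)) (hE : ∀ x, E₃ x = E₁ x + E₂ x)
    (hE₁ : {x | E₁ x ≠ 0}.Finite) (hE₂ : {x | E₂ x ≠ 0}.Finite) {U : Opens X}
    (θ : assocForm Q ρ₁ E₁ U) (s : assocSec Q ρ₂ E₂ U) :
    ∃ h : assocForm Q ρ₃ E₃ U, ∀ p, E₁ (Q.proj p) ≤ 0 → E₂ (Q.proj p) ≤ 0 →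
      ∀ v, h.1 p v = b (θ.1 p v) (s.1 p) := by
  choose W₁ hW₁ g₁ hg₁ e₁ using θ.2.2.2
  choose W₂ hW₂ g₂ hg₂ e₂ using s.2.2.2
  let Φ : P → ∀ y : X, TangentSpace 𝓘(ℂ) y →L[ℂ] V₃ := fun q y =>
    if h : y ∈ U ∧ E₃ y ≤ 0 then (dcoordAt y y).smulRight
      (coordAt y y ^ (-E₃ y) • b (g₁ y h.1 q) (g₂ y h.1 q)) else 0
  let H : ∀ p : P, TangentSpace 𝓘(ℂ) (Q.proj p) →L[ℂ] V₃ := fun p =>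
    if E₁ (Q.proj p) ≤ 0 ∧ E₂ (Q.proj p) ≤ 0 then (b.flip (s.1 p)).comp (θ.1 p)
    else Φ p (Q.proj p)
  have Hgood : ∀ p, E₁ (Q.proj p) ≤ 0 ∧ E₂ (Q.proj p) ≤ 0 →
      H p = (b.flip (s.1 p)).comp (θ.1 p) := fun p h => if_pos h
  have Hbad : ∀ p, ¬ (E₁ (Q.proj p) ≤ 0 ∧ E₂ (Q.proj p) ≤ 0) → H p = Φ p (Q.proj p) :=
    fun p h => if_neg h
  refine ⟨⟨H, fun p hp => ?_, fun p a v => ?_, fun x hx => ?_⟩, fun p h1 h2 v => ?_⟩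
  · by_cases h : E₁ (Q.proj p) ≤ 0 ∧ E₂ (Q.proj p) ≤ 0
    · have hU : Q.proj p ∉ U := fun hU => hp ⟨hU, by rw [hE]; omega⟩
      rw [Hgood p h, θ.2.1 p fun h => hU h.1, ContinuousLinearMap.comp_zero]
    · rw [Hbad p h]
      exact dif_neg hp
  · by_cases h : E₁ (Q.proj p) ≤ 0 ∧ E₂ (Q.proj p) ≤ 0
    · rw [Hgood p h, Hgood (Q.act p a) (by rw [Q.proj_act]; exact h)]
      simp only [ContinuousLinearMap.comp_apply, ContinuousLinearMap.flip_apply]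
      rw [θ.2.2.1, s.2.2.1, hb]
    · rw [Hbad p h, Hbad (Q.act p a) (by rw [Q.proj_act]; exact h),
        tangentCast_apply (fun y v => Φ (Q.act p a) y v)]
      by_cases h' : Q.proj p ∈ U ∧ E₃ (Q.proj p) ≤ 0
      · have h3 : ∀ q, Φ q (Q.proj p) = (dcoordAt (Q.proj p) (Q.proj p)).smulRight
            (coordAt (Q.proj p) (Q.proj p) ^ (-E₃ (Q.proj p)) •
              b (g₁ (Q.proj p) h'.1 q) (g₂ (Q.proj p) h'.1 q)) := fun q => dif_pos h'
        rw [h3, h3]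
        simp only [ContinuousLinearMap.smulRight_apply, map_smul, hb]
        rw [assocForm_germ_equivariant Q θ hE₁ (hg₁ _ h'.1) (hW₁ _ h'.1) (e₁ _ h'.1),
          assocSec_germ_equivariant Q s hE₂ (hg₂ _ h'.1) (hW₂ _ h'.1) (e₂ _ h'.1)]
      · have h3 : ∀ q, Φ q (Q.proj p) = 0 := fun q => dif_neg h'
        rw [h3, h3]; simp
  · have hfin : (({x | E₁ x ≠ 0} ∪ {x | E₂ x ≠ 0}) \ {x}).Finite :=
      (hE₁.union hE₂).subset Set.sdiff_subset
    refine ⟨W₁ x hx ⊓ W₂ x hx ⊓ ⟨(chartAt ℂ x).source, (chartAt ℂ x).open_source⟩ ⊓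
      ⟨(({x | E₁ x ≠ 0} ∪ {x | E₂ x ≠ 0}) \ {x})ᶜ, hfin.isClosed.isOpen_compl⟩,
      ⟨⟨⟨hW₁ x hx, hW₂ x hx⟩, mem_chart_source ℂ x⟩, fun h => h.2 rfl⟩,
      fun q => b (g₁ x hx q) (g₂ x hx q), ?_, ?_⟩
    · exact (b.contMDiff.comp_contMDiffOn ((hg₁ x hx).mono fun p hp => hp.1.1.1)).clm_apply
        ((hg₂ x hx).mono fun p hp => hp.1.1.2)
    · rintro p ⟨⟨⟨p1, p2⟩, p3⟩, p4⟩ h3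
      by_cases h : E₁ (Q.proj p) ≤ 0 ∧ E₂ (Q.proj p) ≤ 0
      · rw [Hgood p h, e₁ x hx p p1 h.1, e₂ x hx p p2 h.2]
        have hz : coordAt x (Q.proj p) ^ (-E₃ x) =
            coordAt x (Q.proj p) ^ (-E₁ x) * coordAt x (Q.proj p) ^ (-E₂ x) := by
          have h0 : -E₃ x = -E₁ x + -E₂ x := by rw [hE]; ring
          rw [h0]
          refine zpow_add' ?_
          by_cases hpx : Q.proj p = x
          · rw [hpx] at h; omega
          · exact Or.inl (coordAt_ne_zero p3 hpx)
        rw [hz]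
        refine ContinuousLinearMap.ext fun v => ?_
        simp only [ContinuousLinearMap.comp_apply, ContinuousLinearMap.flip_apply,
          ContinuousLinearMap.smulRight_apply, map_smul, smul_apply]
        module
      · have hpx : Q.proj p = x := by
          by_contra hpx
          have h1 : E₁ (Q.proj p) = 0 := by_contra fun hh => p4 ⟨Or.inl hh, hpx⟩
          have h2 : E₂ (Q.proj p) = 0 := by_contra fun hh => p4 ⟨Or.inr hh, hpx⟩
          exact h ⟨h1.le, h2.le⟩
        subst hpx
        rw [Hbad p h]
        exact dif_pos ⟨hx, h3⟩
  · change H p v = _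
    rw [Hgood p ⟨h1, h2⟩]
    rfl

variable (ρ₃ E₃) in
/-- The product `P(V₁) ⊗ K_X(E₁) × P(V₂)(E₂) ⟶ P(V₃) ⊗ K_X(E₁ + E₂)` induced by an equivariant
bilinear map `b : V₁ × V₂ → V₃`. It is the section given by `(θ, s) ↦ b(θ, s)` wherever neither of
the factors has a pole. -/
def prodMap (b : V₁ →L[ℂ] V₂ →L[ℂ] V₃)
    (hb : ∀ g x y, ρ₃ g (b x y) = b (ρ₁ g x) (ρ₂ g y)) (hE : ∀ x, E₃ x = E₁ x + E₂ x)
    (hE₁ : {x | E₁ x ≠ 0}.Finite) (hE₂ : {x | E₂ x ≠ 0}.Finite) (U : Opens X) :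
    assocForm Q ρ₁ E₁ U →ₗ[ℂ] assocSec Q ρ₂ E₂ U →ₗ[ℂ] assocForm Q ρ₃ E₃ U :=
  have key : ∀ f f' : assocForm Q ρ₃ E₃ U, (∀ p, E₁ (Q.proj p) ≤ 0 → E₂ (Q.proj p) ≤ 0 →
      ∀ v, f.1 p v = f'.1 p v) → f = f' := fun f f' h =>
    assocForm_ext Q ρ₃ E₃ (hE₁.union hE₂) ((hE₁.union hE₂).subset fun x hx => by
        by_contra hh
        simp only [Set.mem_union, Set.mem_ofPred_eq, not_or, not_not] at hh
        exact hx (by rw [hE, hh.1, hh.2, add_zero]))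
      fun p _ hp => by
        simp only [Set.mem_union, Set.mem_ofPred_eq, not_or, not_not] at hp
        exact ContinuousLinearMap.ext fun v => h p hp.1.le hp.2.le v
  LinearMap.mk₂ ℂ (fun θ s => (exists_prod Q b hb hE hE₁ hE₂ θ s).choose)
    (fun θ θ' s => key _ _ fun p h1 h2 v => by
      refine ((exists_prod Q b hb hE hE₁ hE₂ (θ + θ') s).choose_spec p h1 h2 v).trans ?_
      refine Eq.trans ?_ (congrArg₂ (· + ·)
        ((exists_prod Q b hb hE hE₁ hE₂ θ s).choose_spec p h1 h2 v)
        ((exists_prod Q b hb hE hE₁ hE₂ θ' s).choose_spec p h1 h2 v)).symm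
      change b (θ.1 p v + θ'.1 p v) (s.1 p) = _
      simp)
    (fun c θ s => key _ _ fun p h1 h2 v => by
      refine ((exists_prod Q b hb hE hE₁ hE₂ (c • θ) s).choose_spec p h1 h2 v).trans ?_
      refine Eq.trans ?_ (congrArg (c • ·)
        ((exists_prod Q b hb hE hE₁ hE₂ θ s).choose_spec p h1 h2 v)).symm
      change b (c • θ.1 p v) (s.1 p) = _
      simp)
    (fun θ s s' => key _ _ fun p h1 h2 v => by
      refine ((exists_prod Q b hb hE hE₁ hE₂ θ (s + s')).choose_spec p h1 h2 v).trans ?_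
      refine Eq.trans ?_ (congrArg₂ (· + ·)
        ((exists_prod Q b hb hE hE₁ hE₂ θ s).choose_spec p h1 h2 v)
        ((exists_prod Q b hb hE hE₁ hE₂ θ s').choose_spec p h1 h2 v)).symm
      change b (θ.1 p v) (s.1 p + s'.1 p) = _
      simp)
    (fun c θ s => key _ _ fun p h1 h2 v => by
      refine ((exists_prod Q b hb hE hE₁ hE₂ θ (c • s)).choose_spec p h1 h2 v).trans ?_
      refine Eq.trans ?_ (congrArg (c • ·)
        ((exists_prod Q b hb hE hE₁ hE₂ θ s).choose_spec p h1 h2 v)).symm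
      change b (θ.1 p v) (c • s.1 p) = _
      simp)

theorem prodMap_apply (b : V₁ →L[ℂ] V₂ →L[ℂ] V₃)
    (hb : ∀ g x y, ρ₃ g (b x y) = b (ρ₁ g x) (ρ₂ g y)) (hE : ∀ x, E₃ x = E₁ x + E₂ x)
    (hE₁ : {x | E₁ x ≠ 0}.Finite) (hE₂ : {x | E₂ x ≠ 0}.Finite) (U : Opens X)
    (θ : assocForm Q ρ₁ E₁ U) (s : assocSec Q ρ₂ E₂ U) (p : P) (h1 : E₁ (Q.proj p) ≤ 0)
    (h2 : E₂ (Q.proj p) ≤ 0) (v : TangentSpace 𝓘(ℂ) (Q.proj p)) :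
    (prodMap Q ρ₃ E₃ b hb hE hE₁ hE₂ U θ s).1 p v = b (θ.1 p v) (s.1 p) :=
  (exists_prod Q b hb hE hE₁ hE₂ θ s).choose_spec p h1 h2 v

end

section

variable {V₁ V₂ V₃ : Type*} [NormedAddCommGroup V₁] [NormedSpace ℂ V₁]
  [NormedAddCommGroup V₂] [NormedSpace ℂ V₂] [NormedAddCommGroup V₃] [NormedSpace ℂ V₃]
  {ρ₁ : G → V₁ →L[ℂ] V₁} {ρ₂ : G → V₂ →L[ℂ] V₂} {ρ₃ : G → V₃ →L[ℂ] V₃} {E₁ E₂ E₃ : X → ℤ}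

/-- Restriction of sections of `P(V) ⊗ K_X(E)`. -/
def resForm (ρ : G → V₁ →L[ℂ] V₁) (E : X → ℤ) {U U' : Opens X} (h : U' ≤ U)
    (f : assocForm Q ρ E U) : assocForm Q ρ E U' :=
  ⟨cut Q.proj U' f.1, cut_assocForm Q ρ E U U' h f.1 f.2⟩

/-- Restriction of sections of `P(V)(E)`. -/
def resSec (ρ : G → V₁ →L[ℂ] V₁) (E : X → ℤ) {U U' : Opens X} (h : U' ≤ U)
    (f : assocSec Q ρ E U) : assocSec Q ρ E U' :=
  ⟨cut Q.proj U' f.1, cut_assocSec Q ρ E U U' h f.1 f.2⟩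

theorem prodMap_res [IsManifold 𝓘(ℂ) ω X] (b : V₁ →L[ℂ] V₂ →L[ℂ] V₃)
    (hb : ∀ g x y, ρ₃ g (b x y) = b (ρ₁ g x) (ρ₂ g y)) (hE : ∀ x, E₃ x = E₁ x + E₂ x)
    (hE₁ : {x | E₁ x ≠ 0}.Finite) (hE₂ : {x | E₂ x ≠ 0}.Finite) {U U' : Opens X} (h : U' ≤ U)
    (θ : assocForm Q ρ₁ E₁ U) (s : assocSec Q ρ₂ E₂ U) :
    resForm Q ρ₃ E₃ h (prodMap Q ρ₃ E₃ b hb hE hE₁ hE₂ U θ s) =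
      prodMap Q ρ₃ E₃ b hb hE hE₁ hE₂ U' (resForm Q ρ₁ E₁ h θ) (resSec Q ρ₂ E₂ h s) := by
  refine assocForm_ext Q ρ₃ E₃ (hE₁.union hE₂) ((hE₁.union hE₂).subset fun x hx => by
        by_contra hh
        simp only [Set.mem_union, Set.mem_ofPred_eq, not_or, not_not] at hh
        exact hx (by rw [hE, hh.1, hh.2, add_zero])) fun p hU hp => ?_
  simp only [Set.mem_union, Set.mem_ofPred_eq, not_or, not_not] at hp
  refine ContinuousLinearMap.ext fun v => ?_
  rw [prodMap_apply Q b hb hE hE₁ hE₂ U' _ _ p hp.1.le hp.2.le]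
  have e₁ : (resForm Q ρ₁ E₁ h θ).1 p = θ.1 p := cut_of_mem _ _ _ _ hU
  have e₂ : (resSec Q ρ₂ E₂ h s).1 p = s.1 p := cut_of_mem _ _ _ _ hU
  have e₃ : (resForm Q ρ₃ E₃ h (prodMap Q ρ₃ E₃ b hb hE hE₁ hE₂ U θ s)).1 p =
    (prodMap Q ρ₃ E₃ b hb hE hE₁ hE₂ U θ s).1 p := cut_of_mem _ _ _ _ hU
  rw [e₁, e₂, e₃, prodMap_apply Q b hb hE hE₁ hE₂ U _ _ p hp.1.le hp.2.le]

/-- The map `P(V₁)(E) ⟶ P(V₂)(E)` induced by an equivariant linear map. -/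
def mapSec (E : X → ℤ) (L : V₁ →L[ℂ] V₂) (hL : ∀ g x, L (ρ₁ g x) = ρ₂ g (L x)) (U : Opens X) :
    assocSec Q ρ₁ E U →ₗ[ℂ] assocSec Q ρ₂ E U where
  toFun f := ⟨fun p => L (f.1 p), fun p hp => by beta_reduce; rw [f.2.1 p hp, map_zero], fun p g => by
    beta_reduce; rw [f.2.2.1, hL], fun x hx => by
      obtain ⟨W, hW, g, hg, e⟩ := f.2.2.2 x hx
      exact ⟨W, hW, fun p => L (g p), L.contMDiff.comp_contMDiffOn hg, fun p hp hE => by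
        beta_reduce; rw [e p hp hE, map_smul]⟩⟩
  map_add' f f' := Subtype.ext (funext fun p => map_add L (f.1 p) (f'.1 p))
  map_smul' c f := Subtype.ext (funext fun p => map_smul L c (f.1 p))

/-- The map `P(V₁) ⊗ K_X(E) ⟶ P(V₂) ⊗ K_X(E)` induced by an equivariant linear map. -/
def mapForm (E : X → ℤ) (L : V₁ →L[ℂ] V₂) (hL : ∀ g x, L (ρ₁ g x) = ρ₂ g (L x)) (U : Opens X) :
    assocForm Q ρ₁ E U →ₗ[ℂ] assocForm Q ρ₂ E U where
  toFun f := ⟨fun p => L.comp (f.1 p), fun p hp => by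
      beta_reduce; rw [f.2.1 p hp, ContinuousLinearMap.comp_zero],
    fun p g v => by
      simp only [ContinuousLinearMap.comp_apply]
      rw [f.2.2.1, hL], fun x hx => by
      obtain ⟨W, hW, g, hg, e⟩ := f.2.2.2 x hx
      exact ⟨W, hW, fun p => L (g p), L.contMDiff.comp_contMDiffOn hg, fun p hp hE => by
        beta_reduce; rw [e p hp hE]
        exact ContinuousLinearMap.ext fun v => by simp⟩⟩
  map_add' f f' := Subtype.ext (funext fun p => ContinuousLinearMap.ext fun v =>
    map_add L (f.1 p v) (f'.1 p v))
  map_smul' c f := Subtype.ext (funext fun p => ContinuousLinearMap.ext fun v =>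
    map_smul L c (f.1 p v))

end

/-- The form on `X` corresponding to a section of `P(ℂ) ⊗ K_X`, with `ℂ` the trivial
representation: its value at `π(p)` is the value of the section at `p`. -/
def descFun (f : ∀ p : P, TangentSpace 𝓘(ℂ) (Q.proj p) →L[ℂ] ℂ) (x : X) :
    TangentSpace 𝓘(ℂ) x →L[ℂ] ℂ :=
  (f (Q.pt x)).comp (tangentCast (Q.proj_pt x).symm)

theorem descFun_proj {E : X → ℤ} {U : Opens X}
    (f : assocForm Q (fun _ => ContinuousLinearMap.id ℂ ℂ) E U) (p : P) :
    descFun Q f.1 (Q.proj p) = f.1 p := by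
  obtain ⟨g, hg⟩ := Q.exists_act (q := Q.pt (Q.proj p)) (p := p) (Q.proj_pt _).symm
  refine ContinuousLinearMap.ext fun v => ?_
  refine Eq.trans ?_ (f.2.2.1 p g v)
  have key : ∀ (q q' : P) (h : q = q') (e : Q.proj p = Q.proj q) (e' : Q.proj p = Q.proj q'),
      f.1 q (tangentCast e v) = f.1 q' (tangentCast e' v) := by
    rintro q _ rfl _ _; rfl
  exact key _ _ hg.symm _ _

/-- Sections of `P(ℂ) ⊗ K_X`, with `ℂ` the trivial representation, are holomorphic forms
on `X`. -/
def desc (U : Opens X) :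
    assocForm Q (fun _ => ContinuousLinearMap.id ℂ ℂ) 0 U →ₗ[ℂ] canonSec U where
  toFun f := ⟨descFun Q f.1, fun x hx => by
      rw [descFun, f.2.1 _ fun h => hx (by rw [← Q.proj_pt x]; exact h.1)]
      exact ContinuousLinearMap.zero_comp _, fun x hx => by
      obtain ⟨W, hW, g, hg, e⟩ := f.2.2.2 x hx
      obtain ⟨U', hU', σ, γ, hσ, -, h1, -, -⟩ := Q.locallyTrivial x
      refine ⟨W ⊓ U', ⟨hW, hU'⟩, fun y => g (σ y), ?_, ?_⟩
      · exact hg.comp (hσ.mono fun y hy => hy.2) fun y hy => by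
          change Q.proj (σ y) ∈ W
          rw [h1 y hy.2]; exact hy.1
      · rintro y ⟨y1, y2⟩
        have h3 : ∀ z, z = y → z = Q.proj (σ y) → descFun Q f.1 z
            = (dcoordAt x z).smulRight (g (σ y)) := by
          rintro z hz rfl
          rw [descFun_proj, e (σ y) (by rw [hz]; exact y1) le_rfl]
          simp
        exact h3 y rfl (h1 y y2).symm⟩
  map_add' f f' := rfl
  map_smul' c f := rfl

theorem desc_proj {U : Opens X} (f : assocForm Q (fun _ => ContinuousLinearMap.id ℂ ℂ) 0 U)
    (p : P) : (desc Q U f).1 (Q.proj p) = f.1 p := descFun_proj Q f p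

theorem desc_res {U U' : Opens X} (h : U' ≤ U)
    (f : assocForm Q (fun _ => ContinuousLinearMap.id ℂ ℂ) 0 U) :
    cut id U' (desc Q U f).1 = (desc Q U' (resForm Q _ 0 h f)).1 := by
  funext x
  obtain ⟨p, rfl⟩ : ∃ p, Q.proj p = x := ⟨_, Q.proj_pt x⟩
  rw [desc_proj]
  change _ = cut Q.proj U' f.1 p
  by_cases hp : Q.proj p ∈ U'
  · rw [cut_of_mem id _ _ _ hp, cut_of_mem Q.proj _ _ _ hp, desc_proj]
  · rw [cut_of_notMem id _ _ _ hp, cut_of_notMem Q.proj _ _ _ hp]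

/-! ### The complexes and the pairing -/

/-- A divisor as a function with values in the integers. -/
def dv {Y : Type*} (D : Y →₀ ℕ) : Y → ℤ := fun x => D x

theorem finite_dv {Y : Type*} (D : Y →₀ ℕ) : {x | dv D x ≠ 0}.Finite :=
  D.support.finite_toSet.subset fun x hx => by
    simpa [dv] using hx

theorem finite_neg_dv {Y : Type*} (D : Y →₀ ℕ) : {x | (-dv D) x ≠ 0}.Finite :=
  D.support.finite_toSet.subset fun x hx => by
    simpa [dv] using hx

theorem finite_zero {Y : Type*} : {x : Y | (0 : Y → ℤ) x ≠ 0}.Finite := by simp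

/-- A morphism of presheaves from its components. -/
def pshHom {F F' : Psh X} (φ : ∀ U : Opens X, F.obj (op U) →ₗ[ℂ] F'.obj (op U))
    (nat : ∀ (U V : Opens X) (h : V ≤ U) x, φ V (rs F h x) = rs F' h (φ U x)) : F ⟶ F' where
  app U := ModuleCat.ofHom (φ U.unop)
  naturality U V h := ModuleCat.hom_ext (LinearMap.ext fun x =>
    nat U.unop V.unop (leOfHom h.unop) x)

variable [IsManifold 𝓘(ℂ) ω X]

/-- The morphism `P(V)(E) ⟶ P(V) ⊗ K_X(E')`, `E' = D + E`, given by the action `s ↦ b(θ, s)` of a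
Higgs field `θ`, a section of `ad(P) ⊗ K_X(D)` over `X`. -/
def fieldHom {V : Type u} [NormedAddCommGroup V] [NormedSpace ℂ V] {ρ : G → V →L[ℂ] V}
    (b : EG →L[ℂ] V →L[ℂ] V) (hb : ∀ g x y, ρ g (b x y) = b (Ad g x) (ρ g y)) (D : X →₀ ℕ)
    (θ : assocForm Q (V := EG) Ad (dv D) ⊤) (E E' : X → ℤ) (hE : ∀ x, E' x = dv D x + E x)
    (hfin : {x | E x ≠ 0}.Finite) : assocSecPsh Q ρ E ⟶ assocFormPsh Q ρ E' :=
  pshHom (fun U => prodMap Q ρ E' b hb hE (finite_dv D) hfin U (resForm Q Ad (dv D) le_top θ))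
    fun U U' h x => by
      refine Eq.trans ?_ (prodMap_res Q b hb hE (finite_dv D) hfin h
        (resForm Q Ad (dv D) le_top θ) x).symm
      refine congrArg (fun k => prodMap Q ρ E' b hb hE (finite_dv D) hfin U' k (resSec Q ρ E h x)) ?_
      refine Subtype.ext (funext fun p => ?_)
      by_cases hp : Q.proj p ∈ U'
      · exact (cut_of_mem _ _ _ _ hp).trans
          ((cut_of_mem _ _ _ _ hp).trans (cut_of_mem _ _ _ _ (h hp))).symm
      · exact (cut_of_notMem Q.proj U' θ.1 p hp).trans (cut_of_notMem Q.proj U'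
          (resForm Q Ad (dv D) le_top θ : assocForm Q Ad (dv D) U).1 p hp).symm

theorem fieldHom_apply {V : Type u} [NormedAddCommGroup V] [NormedSpace ℂ V] {ρ : G → V →L[ℂ] V}
    (b : EG →L[ℂ] V →L[ℂ] V) (hb : ∀ g x y, ρ g (b x y) = b (Ad g x) (ρ g y)) (D : X →₀ ℕ)
    (θ : assocForm Q (V := EG) Ad (dv D) ⊤) (E E' : X → ℤ) (hE : ∀ x, E' x = dv D x + E x)
    (hfin : {x | E x ≠ 0}.Finite) (U : Opens X) (x : (assocSecPsh Q ρ E).obj (op U)) (p : P)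
    (hU : Q.proj p ∈ U) (h1 : dv D (Q.proj p) ≤ 0) (h2 : E (Q.proj p) ≤ 0)
    (v : TangentSpace 𝓘(ℂ) (Q.proj p)) :
    formVal (((fieldHom Q b hb D θ E E' hE hfin).app (op U)).hom x) p v
      = b (θ.1 p v) (secVal x p) :=
  (prodMap_apply Q b hb hE (finite_dv D) hfin U (resForm Q Ad (dv D) le_top θ) x p h1 h2 v).trans
    (congrArg (fun k : TangentSpace 𝓘(ℂ) (Q.proj p) →L[ℂ] EG => b (k v) (secVal x p))
      (cut_of_mem Q.proj U θ.1 p hU))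

variable [LieGroup 𝓘(ℂ, EG) ω G]

/-- The coadjoint representation, on the dual of the Lie algebra. -/
def coAd (g : G) : (EG →L[ℂ] ℂ) →L[ℂ] (EG →L[ℂ] ℂ) :=
  (ContinuousLinearMap.compL ℂ EG EG ℂ).flip (Ad g⁻¹)

variable (EG G) in
/-- The transposes of the maps `ad z`: the bilinear map `(z, l) ↦ l ∘ ad z`. -/
def adT : EG →L[ℂ] (EG →L[ℂ] ℂ) →L[ℂ] (EG →L[ℂ] ℂ) :=
  (ContinuousLinearMap.compL ℂ EG EG ℂ).flip ∘L ad EG G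

theorem adT_equivariant (g : G) (z : EG) (l : EG →L[ℂ] ℂ) :
    coAd g (adT EG G z l) = adT EG G (Ad g z) (coAd g l) := by
  refine ContinuousLinearMap.ext fun x => ?_
  change l (ad EG G z (Ad g⁻¹ x)) = l (Ad g⁻¹ (ad EG G (Ad g z) x))
  rw [Ad_ad, ← ContinuousLinearMap.comp_apply (Ad g⁻¹) (Ad g), Ad_inv_comp]
  rfl

theorem eval_equivariant (g : G) (x : EG) (l : EG →L[ℂ] ℂ) :
    ContinuousLinearMap.id ℂ ℂ (l x) = coAd g l (Ad g x) := by
  change l x = l (Ad g⁻¹ (Ad g x))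
  rw [← ContinuousLinearMap.comp_apply (Ad g⁻¹) (Ad g), Ad_inv_comp]
  rfl

variable (D : X →₀ ℕ) (θ : assocForm Q (V := EG) Ad (dv D) ⊤)

/-- The morphism `ad θ : ad(P) ⟶ ad(P) ⊗ K_X(D)`. -/
def adHom : assocSecPsh Q (V := EG) Ad 0 ⟶ assocFormPsh Q (V := EG) Ad (dv D) :=
  fieldHom Q (ad EG G) Ad_ad D θ 0 (dv D) (by simp) finite_zero

/-- The complex `K^• = (ad θ : ad(P) ⟶ ad(P) ⊗ K_X(D))` in degrees `0` and `1`. -/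
def higgsComplex : CochainComplex (Psh X) ℕ := twoTerm (adHom Q D θ)

/-- The transpose `(ad θ)^∨ : ad(P)^∨(-D) ⟶ ad(P)^∨ ⊗ K_X`, `l ↦ l ∘ ad θ`. -/
def adTHom : assocSecPsh Q (V := EG →L[ℂ] ℂ) coAd (-dv D) ⟶
    assocFormPsh Q (V := EG →L[ℂ] ℂ) coAd 0 :=
  fieldHom Q (adT EG G) adT_equivariant D θ (-dv D) 0 (by simp) (finite_neg_dv D)

/-- The complex `Ǩ^• ⊗ K_X`, where `Ǩ^• = Hom(K^•, O_X)[-1]`: its terms in degrees `0` and `1`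
are `(ad(P) ⊗ K_X(D))^∨ ⊗ K_X = ad(P)^∨(-D)` and `ad(P)^∨ ⊗ K_X`, and its differential is the
transpose of the differential of `K^•` with the sign of the shift. -/
def dualComplex : CochainComplex (Psh X) ℕ := twoTerm (-adTHom Q D θ)

/-- The product `(ad(P) ⊗ K_X(D)) × ad(P)^∨(-D) ⟶ P(ℂ) ⊗ K_X`, `(t, l) ↦ l(t)`. -/
def evalOneZeroForm (U : Opens X) : assocForm Q (V := EG) Ad (dv D) U →ₗ[ℂ]
    assocSec Q (V := EG →L[ℂ] ℂ) coAd (-dv D) U →ₗ[ℂ]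
    assocForm Q (fun _ : G => ContinuousLinearMap.id ℂ ℂ) 0 U :=
  prodMap Q (fun _ => ContinuousLinearMap.id ℂ ℂ) 0 (ContinuousLinearMap.apply ℂ ℂ (E := EG))
    eval_equivariant (by simp) (finite_dv D) (finite_neg_dv D) U

/-- The product `ad(P) × (ad(P)^∨ ⊗ K_X) ⟶ P(ℂ) ⊗ K_X`, `(s, l) ↦ l(s)`. -/
def evalZeroOneForm (U : Opens X) : assocSec Q (V := EG) Ad 0 U →ₗ[ℂ]
    assocForm Q (V := EG →L[ℂ] ℂ) coAd 0 U →ₗ[ℂ]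
    assocForm Q (fun _ : G => ContinuousLinearMap.id ℂ ℂ) 0 U :=
  (prodMap Q (fun _ => ContinuousLinearMap.id ℂ ℂ) 0
    (ContinuousLinearMap.id ℂ (EG →L[ℂ] ℂ)) (ρ₁ := coAd) (ρ₂ := Ad)
    (fun g l x => eval_equivariant g x l) (by simp) finite_zero finite_zero U).flip

/-- The component `(ad(P) ⊗ K_X(D)) × ad(P)^∨(-D) ⟶ K_X` of the contraction. -/
def evalOneZero (U : Opens X) : assocForm Q (V := EG) Ad (dv D) U →ₗ[ℂ]
    assocSec Q (V := EG →L[ℂ] ℂ) coAd (-dv D) U →ₗ[ℂ] canonSec U :=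
  (evalOneZeroForm Q D U).compr₂ (desc Q U)

/-- The component `ad(P) × (ad(P)^∨ ⊗ K_X) ⟶ K_X` of the contraction. -/
def evalZeroOne (U : Opens X) : assocSec Q (V := EG) Ad 0 U →ₗ[ℂ]
    assocForm Q (V := EG →L[ℂ] ℂ) coAd 0 U →ₗ[ℂ] canonSec U :=
  (evalZeroOneForm Q U).compr₂ (desc Q U)

/-- The contraction `K^• ⊗ (Ǩ^• ⊗ K_X) ⟶ K_X[-1]`. -/
def evaluation : Contraction (higgsComplex Q D θ) (dualComplex Q D θ) (canonPsh X) 1 :=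
  twoContraction (adHom Q D θ) (-adTHom Q D θ) (evalOneZero Q D) (evalZeroOne Q)
    (fun U U' h t l => Subtype.ext ((desc_res Q h _).trans
      (congrArg (fun k => (desc Q U' k).1) (prodMap_res Q _ _ _ _ _ h t l))))
    (fun U U' h s l => Subtype.ext ((desc_res Q h _).trans
      (congrArg (fun k => (desc Q U' k).1) (prodMap_res Q
        (ContinuousLinearMap.id ℂ (EG →L[ℂ] ℂ)) (fun g l x => eval_equivariant g x l) (by simp)
        finite_zero finite_zero h l s))))
    (fun U x l => by
      refine ((desc Q U).map_add _ _).symm.trans ((congrArg (desc Q U) ?_).trans (map_zero _))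
      refine assocForm_ext Q _ 0 D.support.finite_toSet finite_zero fun p hU hp => ?_
      have hp0 : dv D (Q.proj p) ≤ 0 := by simpa [dv] using hp
      have hp1 : (-dv D) (Q.proj p) ≤ 0 := by simp [dv]
      refine ContinuousLinearMap.ext fun v => ?_
      have e1 : (evalOneZeroForm Q D U (((adHom Q D θ).app (op U)).hom x) l).1 p v
          = secVal l p (formVal (((adHom Q D θ).app (op U)).hom x) p v) :=
        prodMap_apply Q (ContinuousLinearMap.apply ℂ ℂ (E := EG)) eval_equivariant (by simp)
          (finite_dv D) (finite_neg_dv D) U (((adHom Q D θ).app (op U)).hom x) l p hp0 hp1 v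
      have e2 : (evalZeroOneForm Q U x (((-adTHom Q D θ).app (op U)).hom l)).1 p v
          = -(formVal (((adTHom Q D θ).app (op U)).hom l) p v (secVal x p)) :=
        prodMap_apply Q (ContinuousLinearMap.id ℂ (EG →L[ℂ] ℂ))
          (ρ₁ := coAd) (ρ₂ := Ad) (fun g l x => eval_equivariant g x l) (by simp)
          finite_zero finite_zero U (((-adTHom Q D θ).app (op U)).hom l) x p le_rfl le_rfl v
      have e3 := fieldHom_apply Q (ad EG G) Ad_ad D θ 0 (dv D) (by simp) finite_zero U x p hU hp0
        le_rfl v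
      have e4 := fieldHom_apply Q (adT EG G) adT_equivariant D θ (-dv D) 0 (by simp)
        (finite_neg_dv D) U l p hU hp0 hp1 v
      let z : EG := secVal x p
      let L : EG →L[ℂ] ℂ := secVal l p
      refine (congrArg₂ (· + ·) (e1.trans (congrArg (fun w : EG => L w) e3))
        (e2.trans (congrArg (fun k : EG →L[ℂ] ℂ => -(k z)) e4))).trans ?_
      exact add_neg_cancel _)

/-- The duality pairing `ℍ¹(K^•) ⊗ ℍ¹(Ǩ^• ⊗ K_X) ⟶ H¹(X, K_X)`: the cup product, followed by the
map induced by the contraction. -/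
def dualityPairing : Hyper (higgsComplex Q D θ) 1 →ₗ[ℂ] Hyper (dualComplex Q D θ) 1 →ₗ[ℂ]
    Hyper (conc (canonPsh X)) 1 :=
  hyperPair (evaluation Q D θ)

/-- The morphism `ad θ : ad(P)(-D) ⟶ ad(P) ⊗ K_X`. -/
def adHomNeg : assocSecPsh Q (V := EG) Ad (-dv D) ⟶ assocFormPsh Q (V := EG) Ad 0 :=
  fieldHom Q (ad EG G) Ad_ad D θ (-dv D) 0 (by simp) (finite_neg_dv D)

/-- The complex `ad θ : ad(P)(-D) ⟶ ad(P) ⊗ K_X` in degrees `0` and `1`. -/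
def twistedComplex : CochainComplex (Psh X) ℕ := twoTerm (adHomNeg Q D θ)

theorem invariant_coAd {B : EG →L[ℂ] EG →L[ℂ] ℂ}
    (hB : ∀ (g : G) x y, B (Ad g x) (Ad g y) = B x y) (g : G) (x : EG) :
    B (Ad g x) = coAd g (B x) := by
  refine ContinuousLinearMap.ext fun y => ?_
  change B (Ad g x) y = B x (Ad g⁻¹ y)
  rw [← hB g x, ← ContinuousLinearMap.comp_apply (Ad g) (Ad g⁻¹), Ad_comp_inv]
  rfl

/-- The morphism of complexes `(ad θ : ad(P)(-D) ⟶ ad(P) ⊗ K_X) ⟶ Ǩ^• ⊗ K_X` given in both degrees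
by `x ↦ B(x, ·)`, for an invariant bilinear form `B`; an isomorphism when `B` is nondegenerate. -/
def traceMap (B : EG →L[ℂ] EG →L[ℂ] ℂ) (hB : ∀ (g : G) x y, B (Ad g x) (Ad g y) = B x y) :
    twistedComplex Q D θ ⟶ dualComplex Q D θ :=
  twoMap
    (pshHom (F := assocSecPsh Q (V := EG) Ad (-dv D))
      (F' := assocSecPsh Q (V := EG →L[ℂ] ℂ) coAd (-dv D))
      (mapSec Q (-dv D) B (invariant_coAd hB)) fun U U' h x => Subtype.ext (funext fun p => by
        by_cases hp : Q.proj p ∈ U'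
        · exact (congrArg B (cut_of_mem Q.proj U' x.1 p hp)).trans
            (cut_of_mem Q.proj U' (mapSec Q (-dv D) B (invariant_coAd hB) U x).1 p hp).symm
        · exact ((congrArg B (cut_of_notMem Q.proj U' x.1 p hp)).trans (map_zero B)).trans
            (cut_of_notMem Q.proj U' (mapSec Q (-dv D) B (invariant_coAd hB) U x).1 p hp).symm))
    (pshHom (F := assocFormPsh Q (V := EG) Ad 0)
      (F' := assocFormPsh Q (V := EG →L[ℂ] ℂ) coAd 0)
      (mapForm Q 0 B (invariant_coAd hB)) fun U U' h x => Subtype.ext (funext fun p => by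
        by_cases hp : Q.proj p ∈ U'
        · exact (congrArg B.comp (cut_of_mem Q.proj U' x.1 p hp)).trans
            (cut_of_mem Q.proj U' (mapForm Q 0 B (invariant_coAd hB) U x).1 p hp).symm
        · exact ((congrArg B.comp (cut_of_notMem Q.proj U' x.1 p hp)).trans (B.comp_zero)).trans
            (cut_of_notMem Q.proj U' (mapForm Q 0 B (invariant_coAd hB) U x).1 p hp).symm))
    (by
      refine NatTrans.ext (funext fun U => ModuleCat.hom_ext (LinearMap.ext fun x => ?_))
      refine assocForm_ext Q (V := EG →L[ℂ] ℂ) coAd 0 (U := U.unop) D.support.finite_toSet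
        finite_zero fun p hU hp => ?_
      have hp0 : dv D (Q.proj p) ≤ 0 := by simpa [dv] using hp
      have hp1 : (-dv D) (Q.proj p) ≤ 0 := by simp [dv]
      refine ContinuousLinearMap.ext fun v => ?_
      have e3 := fieldHom_apply Q (ad EG G) Ad_ad D θ (-dv D) 0 (by simp) (finite_neg_dv D)
        U.unop x p hU hp0 hp1 v
      have e4 := fieldHom_apply Q (adT EG G) adT_equivariant D θ (-dv D) 0 (by simp)
        (finite_neg_dv D) U.unop (mapSec Q (-dv D) B (invariant_coAd hB) U.unop x) p hU hp0 hp1 v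
      refine Eq.trans (congrArg Neg.neg e4) (Eq.trans ?_ (congrArg B e3).symm)
      refine ContinuousLinearMap.ext fun y => ?_
      exact (eq_neg_of_add_eq_zero_left (invariant_ad B hB _ _ y)).symm)

/-- The Čech cochain `c_{ij} = B(t_i, σ_{ij}) - B(s_{ij}, τ_j)` of the canonical sheaf. Outside the
divisor `D` the sections on the right are defined pointwise; the equality there determines `c`. -/
def IsTraceCochain {Q : HolPrincipalBundle X EG G EP P} {D : X →₀ ℕ} {ι : Type v}
    (U : ι → Opens X) (B : EG →L[ℂ] EG →L[ℂ] ℂ)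
    (s : Cech U (assocSecPsh Q (V := EG) Ad 0) 1)
    (t : Cech U (assocFormPsh Q (V := EG) Ad (dv D)) 0)
    (σ : Cech U (assocSecPsh Q (V := EG) Ad (-dv D)) 1)
    (τ : Cech U (assocFormPsh Q (V := EG) Ad 0) 0) (c : Cech U (canonPsh X) 1) : Prop :=
  ∀ (i j : ι) (p : P), Q.proj p ∈ U i → Q.proj p ∈ U j → D (Q.proj p) = 0 →
    ∀ v : TangentSpace 𝓘(ℂ) (Q.proj p),
      canonVal (c ![i, j]) (Q.proj p) v =
        B (formVal (t ![i]) p v) (secVal (σ ![i, j]) p)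
          - B (secVal (s ![i, j]) p) (formVal (τ ![j]) p v)

end Product

end HiggsDuality

end

open HiggsDuality

namespace HiggsDuality

/-! ### Čech classes in the limit over covers: evaluating induced maps and pairings on
representatives. -/

section Cech

variable {X : Type u} [TopologicalSpace X] {ι : Type v} {κ : Type w}

/-! The duality pairing is a cup product followed by a contraction, so on representatives of degree
one over a common cover it is computed by a two-term formula, `cup_one`. The sign exponent r(m - (p
- r)) with m = p = 1 is 0 for r = 0 and 1 for r = 1; hence the component over U_i ∩ U_j is ⟨t_i,
σ'_{ij}⟩ - ⟨s_{ij}, τ'_j⟩, where (σ', τ') = (Tr(σ, ·), Tr(τ, ·)) is the image of (σ, τ) in the dual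
complex. Evaluating functionals gives Tr(σ_{ij}, t_i) - Tr(τ_j, s_{ij}), and symmetry of Tr turns
this into c_{ij}. This is `isTraceCochain_cup`.

The cochain is a cocycle because its Čech differential over U_i ∩ U_j ∩ U_k reduces, by the cocycle
equations, to ⟨d s_{ij}, σ'_{jk}⟩ + ⟨s_{ij}, d σ'_{jk}⟩, which vanishes since the contraction is a
morphism of complexes. Here the sign of the shift in the dual differential is what makes the two
terms cancel. The invariance of Tr enters elsewhere: Tr([z, x], y) + Tr(x, [z, y]) = 0 is what makes
x ↦ Tr(x, ·) commute with the differentials, so that (σ', τ') is again a cocycle.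

Two points need care. First, hypercohomology is a direct limit over covers indexed by the points of
X, while the cocycles live on an arbitrary cover. `hyperMap_hyperClass` and `hyperPair_hyperClass`
bring the maps on the limit back to the given cover: all classes are restricted along one and the
same choice of index for each point, and every operation involved commutes with restriction.

Second, at a point of D the section t may have a pole while σ vanishes, so the product Tr(t_i,
σ_{ij}) is holomorphic there but is not the product of the encoded values. The cochain c is
therefore prescribed only off the finite support of D. A holomorphic form is determined by its
values off a finite set (`canonSec_ext`), so this prescription has at most one solution
(`IsTraceCochain.unique`), and the cup product is a solution. Every statement about c is thereby a
statement about the cup product. -/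

theorem totMap_refTot {F G : CochainComplex (Psh X) ℕ} (φ : F ⟶ G) {U : ι → Opens X}
    {W : κ → Opens X} (r : κ → ι) (h : ∀ k, W k ≤ U (r k)) (n : ℕ) (α : Tot U F n) :
    totMap φ W n (refTot r h F n α) = refTot r h G n (totMap φ U n α) := by
  funext a i
  exact app_rs _ _ _

/-- Coefficient maps act on each section separately and restriction acts on the open sets, so the
two commute. This allows the image of a class under `traceMap` to be represented on the original
cover, where the cup product can be formed. -/
theorem hyperMap_hyperClass {F G : CochainComplex (Psh X) ℕ} (φ : F ⟶ G) {U : ι → Opens X}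
    (hU : ∀ x, ∃ i, x ∈ U i) {n : ℕ} (z : cocycles U F n) :
    hyperMap φ n (hyperClass hU z) =
      hyperClass hU ⟨totMap φ U n z.1, totMap_mem_cocycles φ U n z.1 z.2⟩ := by
  -- The class is the canonical image of an element of one stage of the direct limit, so the induced
  -- map is evaluated at that stage; both sides then live on the same point-indexed cover.
  refine (Module.DirectLimit.lift_of _ _ _).trans (congrArg (toHyper G n _) ?_)
  exact congrArg Submodule.Quotient.mk
    (Subtype.ext (totMap_refTot φ _ (fun x => le_refl (U (hU x).choose)) n z.1))

/-- The pairing on the limit is built from `meetPair`, which passes to a common refinement of two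
covers. When both covers are V this refinement is the self-intersection of V, and the extra
restriction disappears in the limit. -/
theorem hyperPair_toHyper {F G : CochainComplex (Psh X) ℕ} {K : Psh X} (μ : Contraction F G K 1)
    (V : PtCover X) (a : HCov V.1 F 1) (b : HCov V.1 G 1) :
    hyperPair μ (toHyper F 1 V a) (toHyper G 1 V b) =
      toHyper (conc K) 1 V (covPair μ V.1 a b) := by
  have h1 : hyperPair μ (toHyper F 1 V a) (toHyper G 1 V b) = meetPair μ V V a b := by
    unfold hyperPair toHyper
    -- The pairing is two nested lifts, one for each argument; each is evaluated on an element
    -- coming from stage V.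
    rw [LinearMap.flip_apply, Module.DirectLimit.lift_of, LinearMap.flip_apply,
      Module.DirectLimit.lift_of]
  rw [h1]
  change toHyper (conc K) 1 (V.meet V) (covPair μ _ _ _) = _
  -- The left and right comparisons of V with `V.meet V` prove the same inequality, so one
  -- refinement map acts on both arguments and can be pulled out of the pairing.
  rw [covPair_refH μ id (PtCover.le_meet_left V V), toHyper_refH]

/-- The pairing of two classes given on the same cover is the class of the cup product. -/
theorem hyperPair_hyperClass {F G : CochainComplex (Psh X) ℕ} {K : Psh X}
    (μ : Contraction F G K 1) {U : ι → Opens X} (hU : ∀ x, ∃ i, x ∈ U i)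
    (α : cocycles U F 1) (β : cocycles U G 1) :
    hyperPair μ (hyperClass hU α) (hyperClass hU β) =
      hyperClass hU ⟨mkConc K U (cup μ U 1 1 1 α.1 β.1),
        mkConc_mem_cocycles (cup_cocycle μ U α.2 β.2)⟩ :=
  -- Both classes were restricted with the same choice function from `hU`, so they lie at a single
  -- stage of the limit. `covPair_refH` moves the restriction outside the pairing, which on quotient
  -- representatives is by definition the cup product.
  (hyperPair_toHyper μ _ _ _).trans (congrArg (toHyper (conc K) 1 _) (covPair_refH μ _ _ _ _))

end Cech

/-! ### Identity principle for holomorphic forms off a finite set. -/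

section Geometry

variable {X : Type u} [TopologicalSpace X] [ChartedSpace ℂ X] [T2Space X] [IsManifold 𝓘(ℂ) ω X]

/-- Holomorphic forms which agree away from a finite set are equal. -/
theorem canonSec_ext {U : Opens X} {η η' : canonSec U} {S : Set X} (hS : S.Finite)
    (h : ∀ x ∈ U, x ∉ S → η.1 x = η'.1 x) : η = η' := by
  suffices H : ∀ η : canonSec U, (∀ x ∈ U, x ∉ S → η.1 x = 0) → η = 0 from
    sub_eq_zero.1 (H (η - η') fun x h1 h2 => sub_eq_zero.2 (h x h1 h2))
  clear h η η'
  intro η h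
  refine Subtype.ext (funext fun x => ?_)
  change η.1 x = 0
  by_cases hx : x ∈ U
  · obtain ⟨W, hW, g, hg, e⟩ := η.2.2 x hx
    -- A Riemann surface has no isolated points; without this, values off x would not constrain the
    -- value at x.
    have := neBot_punctured x
    have hcg : ContinuousAt g x := hg.continuousOn.continuousAt (W.2.mem_nhds hW)
    -- The point x may itself belong to S, so it is removed first; what remains is finite, hence
    -- closed, and avoids x.
    have hS' : (S \ {x})ᶜ ∈ 𝓝 x :=
      ((hS.subset Set.sdiff_subset).isClosed.isOpen_compl).mem_nhds (by simp)
    have he : ∀ᶠ y in 𝓝[≠] x, g y = 0 := by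
      filter_upwards [self_mem_nhdsWithin, mem_nhdsWithin_of_mem_nhds hS',
        mem_nhdsWithin_of_mem_nhds (W.2.mem_nhds hW), mem_nhdsWithin_of_mem_nhds (U.2.mem_nhds hx),
        mem_nhdsWithin_of_mem_nhds ((chartAt ℂ x).open_source.mem_nhds (mem_chart_source ℂ x))]
        with y y1 y2 y3 y4 y5
      have h0 := (e y y3).symm.trans (h y y4 fun hy => y2 ⟨hy, y1⟩)
      -- Inside the chart domain dz is nonzero, so the vanishing of g dz at y forces g(y) = 0.
      obtain ⟨v, hv⟩ := DFunLike.ne_iff.1 (dcoordAt_ne_zero y5)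
      have h1 := congrArg (fun k => k v) h0
      simp only [ContinuousLinearMap.smulRight_apply, zero_apply, smul_eq_zero] at h1
      exact h1.resolve_left hv
    -- Only continuity of the coefficient g is used: g vanishes on a punctured neighbourhood of x,
    -- so its limit g(x) is zero.
    have hg0 : g x = 0 := tendsto_nhds_unique ((hcg.tendsto.mono_left nhdsWithin_le_nhds).congr' he)
      tendsto_const_nhds
    rw [e x hW, hg0]
    exact ContinuousLinearMap.ext fun v => smul_zero (dcoordAt x x v)
  · exact η.2.1 x hx

end Geometry

/-! ### The contracted cup product as an explicit trace cochain. -/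

section Product

variable {X : Type u} [TopologicalSpace X] [ChartedSpace ℂ X] [T2Space X] [IsManifold 𝓘(ℂ) ω X]
  {EG : Type u} [NormedAddCommGroup EG] [NormedSpace ℂ EG]
  {G : Type u} [TopologicalSpace G] [ChartedSpace EG G] [Group G]
  {EP : Type u} [NormedAddCommGroup EP] [NormedSpace ℂ EP]
  {P : Type u} [TopologicalSpace P] [ChartedSpace EP P]
  {ι : Type v}

/-- The defining equation fixes the values of the cochain at every point where D vanishes, and the
support of D is finite, so the identity principle for forms applies on each double intersection.
This justifies specifying the cochain by pointwise values only off D. -/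
theorem IsTraceCochain.unique {Q : HolPrincipalBundle X EG G EP P} {D : X →₀ ℕ} {U : ι → Opens X}
    {B : EG →L[ℂ] EG →L[ℂ] ℂ}
    {s : Cech U (assocSecPsh Q (V := EG) Ad 0) 1}
    {t : Cech U (assocFormPsh Q (V := EG) Ad (dv D)) 0}
    {σ : Cech U (assocSecPsh Q (V := EG) Ad (-dv D)) 1}
    {τ : Cech U (assocFormPsh Q (V := EG) Ad 0) 0} {c c' : Cech U (canonPsh X) 1}
    (hc : IsTraceCochain U B s t σ τ c) (hc' : IsTraceCochain U B s t σ τ c') : c = c' := by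
  funext k
  obtain ⟨i, j, rfl⟩ : ∃ i j, k = ![i, j] :=
    ⟨k 0, k 1, by funext a; fin_cases a <;> rfl⟩
  refine canonSec_ext (U := inter U ![i, j]) D.support.finite_toSet fun x hx hD => ?_
  -- The defining equation is tested at points of the bundle, so x is first lifted to a point of its
  -- fibre, which is nonempty by local triviality.
  obtain ⟨p, rfl⟩ : ∃ p, Q.proj p = x := ⟨_, Q.proj_pt x⟩
  have hi : Q.proj p ∈ U i := (iInf_le (fun a => U (![i, j] a)) 0 : _ ≤ U i) hx
  have hj : Q.proj p ∈ U j := (iInf_le (fun a => U (![i, j] a)) 1 : _ ≤ U j) hx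
  have hD0 : D (Q.proj p) = 0 := by simpa using hD
  exact ContinuousLinearMap.ext fun v =>
    (hc i j p hi hj hD0 v).trans (hc' i j p hi hj hD0 v).symm

variable [LieGroup 𝓘(ℂ, EG) ω G]

/-- The contraction with values in K_X is a product on P followed by descent to X, and descent
preserves values at p. The condition on D cannot simply be dropped: at a point of D the encoded
value of t is zero by convention, whereas the product of a pole with a zero may be nonzero. -/
theorem canonVal_evalOneZero (Q : HolPrincipalBundle X EG G EP P) (D : X →₀ ℕ) (U : Opens X)
    (t : assocForm Q (V := EG) Ad (dv D) U)
    (l : assocSec Q (V := EG →L[ℂ] ℂ) coAd (-dv D) U) (p : P) (hp : D (Q.proj p) = 0)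
    (v : TangentSpace 𝓘(ℂ) (Q.proj p)) :
    (evalOneZero Q D U t l).1 (Q.proj p) v = l.1 p (t.1 p v) :=
  (congrArg (fun k : TangentSpace 𝓘(ℂ) (Q.proj p) →L[ℂ] ℂ => k v) (desc_proj Q _ p)).trans
    (prodMap_apply Q (ContinuousLinearMap.apply ℂ ℂ (E := EG)) eval_equivariant (by simp)
      (finite_dv D) (finite_neg_dv D) U t l p (by simp [dv, hp]) (by simp [dv]) v)

/-- Both factors are untwisted here, so neither has a pole and the pointwise formula holds over all
of X. -/
theorem canonVal_evalZeroOne (Q : HolPrincipalBundle X EG G EP P) (U : Opens X)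
    (s : assocSec Q (V := EG) Ad 0 U)
    (l : assocForm Q (V := EG →L[ℂ] ℂ) coAd 0 U) (p : P)
    (v : TangentSpace 𝓘(ℂ) (Q.proj p)) :
    (evalZeroOne Q U s l).1 (Q.proj p) v = l.1 p v (s.1 p) :=
  (congrArg (fun k : TangentSpace 𝓘(ℂ) (Q.proj p) →L[ℂ] ℂ => k v) (desc_proj Q _ p)).trans
    (prodMap_apply Q (ContinuousLinearMap.id ℂ (EG →L[ℂ] ℂ)) (ρ₁ := coAd) (ρ₂ := Ad)
      (fun g l x => eval_equivariant g x l) (by simp) finite_zero finite_zero U l s p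
      le_rfl le_rfl v)

/-- The contracted cup product of `(s, t)` with the image of `(σ, τ)` under `x ↦ B(x, ·)` is the
cochain `B(t_i, σ_{ij}) - B(s_{ij}, τ_j)`. -/
theorem isTraceCochain_cup (Q : HolPrincipalBundle X EG G EP P) (D : X →₀ ℕ)
    (θ : assocForm Q (V := EG) Ad (dv D) ⊤) (B : EG →L[ℂ] EG →L[ℂ] ℂ)
    (hsymm : ∀ x y, B x y = B y x)
    (hinv : ∀ (g : G) (x y : EG), B (Ad g x) (Ad g y) = B x y) (U : ι → Opens X)
    (s : Cech U (assocSecPsh Q (V := EG) Ad 0) 1)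
    (t : Cech U (assocFormPsh Q (V := EG) Ad (dv D)) 0)
    (σ : Cech U (assocSecPsh Q (V := EG) Ad (-dv D)) 1)
    (τ : Cech U (assocFormPsh Q (V := EG) Ad 0) 0) :
    IsTraceCochain U B s t σ τ (cup (evaluation Q D θ) U 1 1 1 (mkTot (adHom Q D θ) U s t)
      (totMap (traceMap Q D θ B hinv) U 1 (mkTot (adHomNeg Q D θ) U σ τ))) := by
  intro i j p hi hj hD v
  let k : Fin 2 → ι := ![i, j]
  have hp : Q.proj p ∈ inter U k := by
    have h : U i ⊓ U j ≤ inter U k := le_iInf fun a => by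
      fin_cases a
      · exact inf_le_left
      · exact inf_le_right
    exact h ⟨hi, hj⟩
  -- The cup product indexes its faces by composites with k, whereas the trace cochain uses literal
  -- tuples. These agree as functions, but the sections they index have different types.
  have k0 : (k ∘ fun _ : Fin 1 => 0) = ![i] := by funext a; fin_cases a; rfl
  have k1 : (k ∘ fun _ : Fin 1 => 1) = ![j] := by funext a; fin_cases a; rfl
  -- Quantifying over a variable index l allows the equality of indices to be substituted without
  -- transporting sections between different open sets. After that, restriction does not change the
  -- value at p, since p lies over the double intersection.
  have ht : ∀ (l : Fin 1 → ι) (e : l = ![i]) (h : inter U k ≤ inter U l),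
      formVal (rs (assocFormPsh Q (V := EG) Ad (dv D)) h (t l)) p = formVal (t ![i]) p := by
    rintro _ rfl h
    exact cut_of_mem Q.proj (inter U k) (fun q => formVal (t ![i]) q) p hp
  have hτ : ∀ (l : Fin 1 → ι) (e : l = ![j]) (h : inter U k ≤ inter U l),
      formVal (rs (assocFormPsh Q (V := EG →L[ℂ] ℂ) coAd 0) h
        (mapForm Q 0 B (invariant_coAd hinv) (inter U l) (τ l))) p
        = B.comp (formVal (τ ![j]) p) := by
    rintro _ rfl h
    exact cut_of_mem Q.proj (inter U k) (fun q => B.comp (formVal (τ ![j]) q)) p hp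
  -- The assumption that D vanishes at the point is used only for this term, the one in which t may
  -- have a pole.
  have h10 := canonVal_evalOneZero Q D (inter U k)
    (rs (assocFormPsh Q (V := EG) Ad (dv D)) (inter_comp_le U k fun _ => 0) (t (k ∘ fun _ => 0)))
    (mapSec Q (-dv D) B (invariant_coAd hinv) (inter U k) (σ k)) p hD v
  have h01 := canonVal_evalZeroOne Q (inter U k) (s k)
    (rs (assocFormPsh Q (V := EG →L[ℂ] ℂ) coAd 0) (inter_comp_le U k fun _ => 1)
      (mapForm Q 0 B (invariant_coAd hinv) (inter U (k ∘ fun _ => 1)) (τ (k ∘ fun _ => 1)))) p v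
  -- `cup_one` supplies both terms and the minus sign. The components of `mkTot`, `totMap` and
  -- `evaluation` in these degrees unfold definitionally to the sections named in `h10` and `h01`.
  refine (congrArg (fun η : (canonPsh X).obj (op (inter U k)) => canonVal η (Q.proj p) v)
    (cup_one (evaluation Q D θ) U _ _ k)).trans ?_
  refine congrArg₂ (· - ·) (h10.trans ?_) (h01.trans ?_)
  · refine (congrArg (fun f : TangentSpace 𝓘(ℂ) (Q.proj p) →L[ℂ] EG =>
      B (secVal (σ k) p) (f v)) (ht _ k0 _)).trans ?_
    -- The dual complex contains the functional B(σ, ·), so evaluation yields B(σ_{ij}, t_i);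
    -- symmetry restores the order in the formula. The τ-term below is handled in the same way.
    exact hsymm _ _
  · refine (congrArg (fun f : TangentSpace 𝓘(ℂ) (Q.proj p) →L[ℂ] EG →L[ℂ] ℂ =>
      f v (secVal (s k) p)) (hτ _ k1 _)).trans ?_
    exact hsymm _ _

end Product

end HiggsDuality

/-! ### The duality pairing on explicit Čech cocycles. -/

theorem mainTheorem5
    {X : Type u} [TopologicalSpace X] [T2Space X] [CompactSpace X] [ConnectedSpace X]
    [ChartedSpace ℂ X] [IsManifold 𝓘(ℂ) ω X]
    {EG : Type u} [NormedAddCommGroup EG] [NormedSpace ℂ EG] [FiniteDimensional ℂ EG]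
    {G : Type u} [TopologicalSpace G] [ChartedSpace EG G] [Group G] [LieGroup 𝓘(ℂ, EG) ω G]
    {EP : Type u} [NormedAddCommGroup EP] [NormedSpace ℂ EP]
    {P : Type u} [TopologicalSpace P] [ChartedSpace EP P] [IsManifold 𝓘(ℂ, EP) ω P]
    (Q : HolPrincipalBundle X EG G EP P) (D : X →₀ ℕ)
    (θ : assocForm Q (V := EG) Ad (dv D) ⊤)
    (B : EG →L[ℂ] EG →L[ℂ] ℂ) (hsymm : ∀ x y, B x y = B y x)
    (hinv : ∀ (g : G) (x y : EG), B (Ad g x) (Ad g y) = B x y)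
    {ι : Type v} (U : ι → Opens X) (hU : ∀ x, ∃ i, x ∈ U i)
    (s : Cech U (assocSecPsh Q (V := EG) Ad 0) 1)
    (t : Cech U (assocFormPsh Q (V := EG) Ad (dv D)) 0)
    (σ : Cech U (assocSecPsh Q (V := EG) Ad (-dv D)) 1)
    (τ : Cech U (assocFormPsh Q (V := EG) Ad 0) 0)
    (hst : mkTot (adHom Q D θ) U s t ∈ cocycles U (higgsComplex Q D θ) 1)
    (hστ : mkTot (adHomNeg Q D θ) U σ τ ∈ cocycles U (twistedComplex Q D θ) 1) :
    (∃ c : Cech U (canonPsh X) 1, IsTraceCochain U B s t σ τ c) ∧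
    ∀ c : Cech U (canonPsh X) 1, IsTraceCochain U B s t σ τ c →
      ∃ hc : mkConc (canonPsh X) U c ∈ cocycles U (conc (canonPsh X)) 1,
        dualityPairing Q D θ (hyperClass hU ⟨mkTot (adHom Q D θ) U s t, hst⟩)
            (hyperMap (traceMap Q D θ B hinv) 1
              (hyperClass hU ⟨mkTot (adHomNeg Q D θ) U σ τ, hστ⟩)) =
          hyperClass hU ⟨mkConc (canonPsh X) U c, hc⟩ := by
  have h := isTraceCochain_cup Q D θ B hsymm hinv U s t σ τ
  -- The cup product itself witnesses existence: its construction already extends the products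
  -- holomorphically across D.
  refine ⟨⟨_, h⟩, fun c hc => ?_⟩
  -- By uniqueness any admissible c is this cup product, so no property of c has to be checked
  -- through its pointwise formula.
  obtain rfl := hc.unique h
  refine ⟨mkConc_mem_cocycles (cup_cocycle (evaluation Q D θ) U hst
    (totMap_mem_cocycles (traceMap Q D θ B hinv) U 1 _ hστ)), ?_⟩
  -- Once the comparison map acts on the representative, both classes come from cocycles on the same
  -- cover U and the general formula for the pairing applies.
  rw [hyperMap_hyperClass]
  exact hyperPair_hyperClass (evaluation Q D θ) hU _ _
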